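/- **Theorem (type $C_\ell$, $\ell$ even).** Let $\ell\ge 2$ be even and let $\Phi$ be a (reduced, crystallographic) root system of type $C_\ell$ in a Euclidean space $E$ with inner product $(\cdot,\cdot)$ and Weyl group $W$ (for $\ell=2$, $C_2=B_2$), with simple roots $\alpha_1,\dots,\alpha_\ell$, labelled so that $\alpha_1,\dots,\alpha_\ell$ have the Cartan matrix of type $C_\ell$ with $\alpha_\ell$ the long simple root. Let $Z=\{x\in E : (\alpha,x)\in\mathbb Z \text{ for all } \alpha\in\Phi\}$ be the coweight lattice. For an integer $q>0$ let $M(\Phi;q)$ be the set of classes in $Z/qZ$ of those $x\in Z$ with $(\beta,x)\not\equiv 0 \pmod q$ for all $\beta\in\Phi$, and let $\chi_{\Phi,q}$ be the permutation character of $W$ on $M(\Phi;q)$, i.e. $\chi_{\Phi,q}(w)=\#\{t\in M(\Phi;q): w(t)=t\}$. Let $\omega_\ell=w_\ell w_0$, where $w_0$ is the longest element of $W$ and $w_\ell$ is the longest element of the subgroup generated by the reflections in $\alpha_1,\dots,\alpha_{\ell-1}$. Then for every integer $q>0$: - $\chi_{\Phi,q}(1)=(q-1)(q-3)\cdots(q-(2\ell-1))$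 if $q$ is odd, and $\chi_{\Phi,q}(1)=(q-2)(q-4)\cdots(q-2(\ell-1))\,(q-\ell)$ if $q$ is even; - $\chi_{\Phi,q}(\omega_\ell)=0$ if $\gcd(4,q)=1$; - $\chi_{\Phi,q}(\omega_\ell)=(q-2)(q-6)\cdots(q-2(\ell-1))$ if $\gcd(4,q)=2$; - $\chi_{\Phi,q}(\omega_\ell)=(q-4)(q-8)\cdots(q-2(\ell-2))\,(q-\ell)$ if $\gcd(4,q)=4$. Moreover, write $\omega=\omega_\ell$, $E^{\omega}=\{x\in E:\omega(x)=x\}$, $x^\omega=\frac1{o(\omega)}\sum_{t=1}^{o(\omega)}\omega^t(x)$ with $o(\omega)$ the order of $\omega$, and $\Phi_{\mathrm{re}}^\omega=\{\beta^\omega:\beta\in\Phi,\ \beta^\omega\ne0\}\subset E^\omega$. Then $o(\omega)=2$, $\Phi_{\mathrm{re}}^\omega$ is a root system of type $C_{\ell/2}$ in $E^\omega$ (where $C_1=A_1$), and, with $M$ the coweight lattice of $\Phi_{\mathrm{re}}^\omega$ in $E^\omega$, $$\chi_{\Phi,q}(\omega)=c(q)\cdot\#\{\bar x\in M/qM : (2\beta,x)\not\equiv0\pmod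 q\text{ for all }\beta\in\Phi_{\mathrm{re}}^\omega\},$$ where $c(q)=\varphi(o(\omega))=1$ if $o(\omega)=2$ divides $q$, and $c(q)=0$ otherwise. -/

import Mathlib

open scoped RealInnerProductSpace

noncomputable section

namespace EquivQuasi

/-! ### Longest elements -/

/-- The length of `w` with respect to a generating set `S` of involutions: the least length of a
word in elements of `S` whose product is `w`. -/
def wordLength {G : Type*} [Group G] (S : Set G) (w : G) : ℕ :=
  sInf {n | ∃ l : List G, (∀ s ∈ l, s ∈ S) ∧ l.prod = w ∧ l.length = n}

/-- `w` is an element of maximal length in the subgroup generated by `S`. -/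
def IsLongest {G : Type*} [Group G] (S : Set G) (w : G) : Prop :=
  w ∈ Subgroup.closure S ∧ ∀ v ∈ Subgroup.closure S, wordLength S v ≤ wordLength S w

/-- The longest element of the group generated by `S`. -/
def longestElement {G : Type*} [Group G] (S : Set G) : G :=
  Classical.epsilon (IsLongest S)

/-! ### Lattices and complements modulo `q` -/

section Lattices

variable {V : Type*} [NormedAddCommGroup V] [InnerProductSpace ℝ V]

/-- The coweight lattice of a set of vectors `Φ`: all `x` with `(α, x) ∈ ℤ` for every `α ∈ Φ`. -/
def coweightLattice (Φ : Set V) : AddSubgroup V where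
  carrier := {x | ∀ α ∈ Φ, ∃ n : ℤ, ⟪α, x⟫ = n}
  zero_mem' := fun _ _ => ⟨0, by simp⟩
  add_mem' := by
    intro x y hx hy α hα
    obtain ⟨m, hm⟩ := hx α hα
    obtain ⟨n, hn⟩ := hy α hα
    exact ⟨m + n, by rw [inner_add_right, hm, hn]; push_cast; rfl⟩
  neg_mem' := by
    intro x hx α hα
    obtain ⟨m, hm⟩ := hx α hα
    exact ⟨-m, by rw [inner_neg_right, hm]; push_cast; rfl⟩

/-- The subgroup `q A` of an abelian group `A`. -/
def multiples (A : Type*) [AddCommGroup A] (q : ℕ) : AddSubgroup A :=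
  (nsmulAddMonoidHom (α := A) q).range

/-- The quotient `A / q A`. -/
abbrev ModQ (A : Type*) [AddCommGroup A] (q : ℕ) : Type _ := A ⧸ multiples A q

/-- The complement `M(Φ, L; q)`: the classes in `L / q L` of those `x ∈ L` such that
`(β, x) ≢ 0 (mod q)` for all `β ∈ Φ`. -/
def modComplement (Φ : Set V) (L : AddSubgroup V) (q : ℕ) : Set (ModQ L q) :=
  (fun x : L => (QuotientAddGroup.mk x : ModQ L q)) ''
    {x : L | ∀ β ∈ Φ, ∀ k : ℤ, ⟪β, (x : V)⟫ ≠ (q : ℝ) * k}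

/-- The characteristic quasi-polynomial of `Φ` with respect to the lattice `L`, evaluated
at `q`. -/
def charQuasi (Φ : Set V) (L : AddSubgroup V) (q : ℕ) : ℕ :=
  Nat.card (modComplement Φ L q)

/-- The dilation `d Φ`. -/
def dilate (d : ℝ) (Φ : Set V) : Set V := (fun β => d • β) '' Φ

/-- A root pairing of a real inner product space with itself which is a root system in the
Euclidean sense: the pairing is the inner product and the coroot of a root `α` is
`2 α / (α, α)`. -/
class IsEuclidean {ι : Type*} (P : RootPairing ι ℝ V V) : Prop where
  pairing_eq : ∀ x y : V, P.toLinearMap x y = ⟪x, y⟫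
  coroot_eq : ∀ i, P.coroot i = (2 / ⟪P.root i, P.root i⟫) • P.root i

/-- The enumeration `α_1, …, α_n` (indexed by `Fin n`) of the simple roots of the base `b` has
the Cartan matrix of type `C_n` (so for `n ≥ 2` the last simple root is the long one). -/
def IsTypeCLabelling {ι : Type*} {P : RootPairing ι ℝ V V} [P.IsCrystallographic] (b : P.Base)
    {n : ℕ} (e : Fin n ≃ b.support) : Prop :=
  ∀ i j, b.cartanMatrix (e i) (e j) = CartanMatrix.C n i j

/-- The set `Φ ⊆ V` is a (reduced, crystallographic) root system of type `C_n` in the Euclidean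
space `V`. -/
def IsRootSystemOfTypeC (n : ℕ) (Φ : Set V) : Prop :=
  Φ.Finite ∧ ∃ P : RootPairing Φ ℝ V V, (∀ β : Φ, P.root β = β) ∧
    IsEuclidean P ∧ P.IsRootSystem ∧ P.IsReduced ∧
    ∃ _ : P.IsCrystallographic, ∃ b : P.Base, ∃ e : Fin n ≃ b.support, IsTypeCLabelling b e

end Lattices

/-! ### The Weyl group and its permutation character -/

section Weyl

variable {ι E : Type*} [NormedAddCommGroup E] [InnerProductSpace ℝ E]

/-- The coweight lattice `Z` of a Euclidean root system. -/
abbrev latticeZ (P : RootPairing ι ℝ E E) : AddSubgroup E := coweightLattice (Set.range P.root)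

lemma inner_weyl_smul (P : RootPairing ι ℝ E E) [IsEuclidean P] (w : P.weylGroup) (x y : E) :
    ⟪w • x, w • y⟫ = ⟪x, y⟫ := by
  revert x y
  obtain ⟨w, hw⟩ := w
  induction hw using RootPairing.weylGroup.induction with
  | mem i =>
    intro x y
    change ⟪P.reflection i x, P.reflection i y⟫ = ⟪x, y⟫
    have h0 : ⟪P.root i, P.root i⟫ ≠ 0 := by
      simpa using P.ne_zero i
    have hc : ∀ z, P.coroot' i z = 2 / ⟪P.root i, P.root i⟫ * ⟪P.root i, z⟫ := by
      intro z
      change P.toLinearMap z (P.coroot i) = _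
      rw [IsEuclidean.pairing_eq, IsEuclidean.coroot_eq, inner_smul_right,
        real_inner_comm z]
    rw [P.reflection_apply, P.reflection_apply, hc, hc]
    simp only [inner_sub_left, inner_sub_right, inner_smul_left, inner_smul_right,
      real_inner_comm (P.root i) x, RCLike.conj_to_real]
    field_simp
    ring
  | one => intro x y; rfl
  | mul g₁ g₂ hg₁ hg₂ h₁ h₂ =>
    intro x y
    exact (h₁ _ _).trans (h₂ x y)

lemma weyl_smul_mem (P : RootPairing ι ℝ E E) [IsEuclidean P] (w : P.weylGroup) {x : E}
    (hx : x ∈ latticeZ P) : w • x ∈ latticeZ P := by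
  rintro _ ⟨i, rfl⟩
  obtain ⟨n, hn⟩ := hx _ ⟨P.weylGroupToPerm w⁻¹ i, rfl⟩
  refine ⟨n, ?_⟩
  rw [← hn, ← P.weylGroup_apply_root, ← inner_weyl_smul P w (w⁻¹ • P.root i), smul_inv_smul]

/-- The action of a Weyl group element on the coweight lattice. -/
def weylHom (P : RootPairing ι ℝ E E) [IsEuclidean P] (w : P.weylGroup) :
    latticeZ P →+ latticeZ P where
  toFun x := ⟨w • (x : E), weyl_smul_mem P w x.2⟩
  map_zero' := Subtype.ext (smul_zero w)
  map_add' x y := Subtype.ext (smul_add w (x : E) (y : E))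

lemma multiples_le_comap {A : Type*} [AddCommGroup A] (f : A →+ A) (q : ℕ) :
    multiples A q ≤ (multiples A q).comap f := by
  rintro _ ⟨x, rfl⟩
  exact ⟨f x, by simp⟩

/-- The action `π_q(x) ↦ π_q(w x)` of the Weyl group on `Z / q Z`. -/
instance weylActionModQ (P : RootPairing ι ℝ E E) [IsEuclidean P] (q : ℕ) :
    MulAction P.weylGroup (ModQ (latticeZ P) q) where
  smul w := QuotientAddGroup.map _ _ (weylHom P w) (multiples_le_comap _ q)
  one_smul t := by
    induction t using QuotientAddGroup.induction_on with
    | H x => exact congrArg QuotientAddGroup.mk (Subtype.ext (one_smul P.weylGroup (x : E)))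
  mul_smul v w t := by
    induction t using QuotientAddGroup.induction_on with
    | H x => exact congrArg QuotientAddGroup.mk (Subtype.ext (mul_smul v w (x : E)))

lemma smul_mk (P : RootPairing ι ℝ E E) [IsEuclidean P] (q : ℕ) (w : P.weylGroup)
    (x : latticeZ P) :
    w • (QuotientAddGroup.mk x : ModQ (latticeZ P) q) = QuotientAddGroup.mk (weylHom P w x) :=
  rfl

/-- The complement `M(Φ; q)` in `Z / q Z`. -/
abbrev complement (P : RootPairing ι ℝ E E) (q : ℕ) : Set (ModQ (latticeZ P) q) :=
  modComplement (Set.range P.root) (latticeZ P) q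

lemma smul_mem_complement (P : RootPairing ι ℝ E E) [IsEuclidean P] (q : ℕ) (w : P.weylGroup)
    {t : ModQ (latticeZ P) q} (ht : t ∈ complement P q) : w • t ∈ complement P q := by
  obtain ⟨x, hx, rfl⟩ := ht
  refine ⟨weylHom P w x, ?_, rfl⟩
  rintro _ ⟨i, rfl⟩ k
  have h := hx _ ⟨P.weylGroupToPerm w⁻¹ i, rfl⟩ k
  rw [← P.weylGroup_apply_root, ← inner_weyl_smul P w (w⁻¹ • P.root i), smul_inv_smul] at h
  exact h

/-- The action of the Weyl group on `M(Φ; q)`. -/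
instance weylActionComplement (P : RootPairing ι ℝ E E) [IsEuclidean P] (q : ℕ) :
    MulAction P.weylGroup (complement P q) where
  smul w t := ⟨w • (t : ModQ (latticeZ P) q), smul_mem_complement P q w t.2⟩
  one_smul t := Subtype.ext (one_smul P.weylGroup (t : ModQ (latticeZ P) q))
  mul_smul v w t := Subtype.ext (mul_smul v w (t : ModQ (latticeZ P) q))

/-- The equivariant characteristic quasi-polynomial `χ_{Φ,q}`: the permutation character of the
Weyl group on `M(Φ; q)`, that is, `w ↦ #{t ∈ M(Φ; q) | w t = t}`. -/
def equivChar (P : RootPairing ι ℝ E E) [IsEuclidean P] (q : ℕ) (w : P.weylGroup) : ℕ :=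
  Nat.card (MulAction.fixedBy (complement P q) w)

/-- The reflections in the simple roots `α_i`, `i ∈ I`. -/
def simpleReflections {P : RootPairing ι ℝ E E} (I : Set ι) : Set P.weylGroup :=
  RootPairing.weylGroup.ofIdx P '' I

/-- `ω_j = w_j w_0`, where `w_0` is the longest element of the Weyl group and `w_j` is the longest
element of the Weyl group generated by the reflections in the simple roots other than `α_j`. -/
def omega {P : RootPairing ι ℝ E E} (b : P.Base) (j : b.support) : P.weylGroup :=
  longestElement (simpleReflections ((b.support : Set ι) \ {(j : ι)})) *
    longestElement (simpleReflections (b.support : Set ι))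

/-! ### Folding -/

/-- The space `E^w` of vectors fixed by `w`. -/
def fixedSpace {P : RootPairing ι ℝ E E} (w : P.weylGroup) : Submodule ℝ E where
  carrier := {x | w • x = x}
  zero_mem' := smul_zero w
  add_mem' := by
    intro x y hx hy
    change w • (x + y) = x + y
    rw [smul_add, hx, hy]
  smul_mem' := by
    intro c x hx
    change w • (c • x) = c • x
    rw [smul_comm, hx]

/-- The average `x^w = o(w)⁻¹ ∑_{t = 1}^{o(w)} w^t x`, where `o(w)` is the order of `w`. -/
def average {P : RootPairing ι ℝ E E} (w : P.weylGroup) (x : E) : E :=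
  (orderOf w : ℝ)⁻¹ • ∑ t ∈ Finset.Icc 1 (orderOf w), w ^ t • x

/-- The set `{β^w | β ∈ Φ, β^w ≠ 0}`, as a subset of the Euclidean space `E^w`. -/
def foldedRoots (P : RootPairing ι ℝ E E) (w : P.weylGroup) : Set (fixedSpace w) :=
  {v | v ≠ 0 ∧ ∃ i, average w (P.root i) = v}

end Weyl

end EquivQuasi

end

open scoped RealInnerProductSpace
noncomputable section
namespace EquivQuasi

/-! ### Counting tuples of pairwise inequivalent elements -/

section Counting

open Finset

/-! Everything is read off from an orthogonal frame. The Cartan matrix lets one solve for orthogonal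
vectors ε_i of equal length with simple roots ε_i - ε_{i+1} and 2ε_{ℓ-1}, indices starting at 0
(`exists_isFrame`); the Weyl group realizes all signed permutations of the ε_i, so Φ consists of the
nonzero sums of two vectors ±ε_i (`range_root_eq`). A coweight x becomes a tuple of integers y_i =
2(ε_i, x) of one common parity, and two coweights agree modulo q exactly when their tuples agree
modulo 2q, possibly after adding q to every entry (`IsFrame.mk_eq_mk_iff`). Hence 2·#M(Φ;q) is the
number of tuples in ℤ/2q of constant parity for which no 2y_i and no y_i ± y_j (i ≠ j) vanishes.

Such tuples are counted greedily for each parity p: u and v conflict when d(u + v) = 0 or d(u - v) =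
0, an equivalence relation with classes of size 2T, where T is the number of residues killed by the
dilation factor d. With A_p admissible residues of parity p, the count is the sum over p of ∏_{k<n}
(A_p - 2Tk) (`natCard_avoidingTuples`). If A_0 ≠ A_1, the two products share all factors but one,
and their sum produces the exceptional factor q - ℓ (`prod_add_prod`).

Lengths in the Weyl group are numbers of inversions, which identifies w_0 with -1 and w_ℓ with the
reversal of the frame, so ω ε_i = -ε_{rev i} (`omega_smul`). A class fixed by ω satisfies y_i +
y_{rev i} = 0 for all i, or y_i + y_{rev i} = q for all i; the first is forbidden by the root ε_i +
ε_{rev i}, and the second is impossible for odd q because the entries have equal parity. For even q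
the first half of y determines the rest, and the avoidance conditions become those for d = 2 on ℓ/2
entries (`natCard_mirrorTuples_of_even`).

The vectors (ε_i - ε_{rev i})/2 form a frame of E^ω whose root system is the folded one
(`IsFrame.foldedRoots_eq`), so the frame count applied to it with d = 2 gives the same number. This
proves both the product formulas and the folding formula. -/

open Classical in
/-- The tuples in `A` whose entries are pairwise unrelated. -/
def unrelatedTuples {α : Type*} [Fintype α] (A : Finset α) (R : α → α → Prop) (n : ℕ) :
    Finset (Fin n → α) :=
  {f | (∀ i, f i ∈ A) ∧ ∀ i j, i ≠ j → ¬ R (f i) (f j)}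

open Classical in
-- The classes of the entries of f are pairwise disjoint and each meets A in D elements, so exactly
-- nD elements of A are excluded.
lemma card_avoiding {α : Type*} [Fintype α] {A : Finset α} {R : α → α → Prop} {D n : ℕ}
    (hsymm : ∀ u v, R u v → R v u) (htrans : ∀ u v w, R u v → R v w → R u w)
    (hcard : ∀ u ∈ A, #{v ∈ A | R u v} = D)
    {f : Fin n → α} (hf : f ∈ unrelatedTuples A R n) :
    (#{v ∈ A | ∀ i, ¬ R (f i) v} : ℤ) = #A - D * n := by
  simp only [unrelatedTuples, mem_filter, mem_univ, true_and] at hf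
  have h1 : #(univ.biUnion fun i => {v ∈ A | R (f i) v}) = n * D := by
    rw [card_biUnion, sum_congr rfl fun i _ => hcard (f i) (hf.1 i)]
    · simp
    · intro i _ j _ hij
      refine disjoint_left.2 fun v hv hw => hf.2 i j hij ?_
      simp only [mem_filter] at hv hw
      exact htrans _ _ _ hv.2 (hsymm _ _ hw.2)
  have h2 : #{v ∈ A | ∀ i, ¬ R (f i) v} + #(univ.biUnion fun i => {v ∈ A | R (f i) v}) = #A := by
    rw [← card_union_of_disjoint]
    · congr 1
      ext v
      simp only [mem_union, mem_filter, mem_biUnion, mem_univ, true_and]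
      by_cases h : ∃ i, R (f i) v
      · grind
      · grind
    · refine disjoint_left.2 fun v hv hw => ?_
      simp only [mem_filter, mem_biUnion, mem_univ, true_and] at hv hw
      obtain ⟨i, -, hi⟩ := hw
      exact hv.2 i hi
  rw [h1] at h2
  rw [← h2]
  push_cast
  ring

open Classical in
-- Dropping the last entry maps tuples of length n + 1 to tuples of length n, and every fibre has
-- the size computed in `card_avoiding`.
lemma card_unrelatedTuples {α : Type*} [Fintype α] {A : Finset α} {R : α → α → Prop} {D : ℕ}
    (hsymm : ∀ u v, R u v → R v u) (htrans : ∀ u v w, R u v → R v w → R u w)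
    (hcard : ∀ u ∈ A, #{v ∈ A | R u v} = D) (n : ℕ) :
    (#(unrelatedTuples A R n) : ℤ) = ∏ k ∈ range n, ((#A : ℤ) - D * k) := by
  induction n with
  | zero => simp [unrelatedTuples]
  | succ n ih =>
    rw [prod_range_succ, ← ih]
    have hmap : ∀ f ∈ unrelatedTuples A R (n + 1), Fin.init f ∈ unrelatedTuples A R n := by
      intro f hf
      simp only [unrelatedTuples, mem_filter, mem_univ, true_and] at hf ⊢
      exact ⟨fun i => hf.1 _, fun i j hij => hf.2 _ _ (by simpa using hij)⟩
    rw [card_eq_sum_card_fiberwise hmap]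
    push_cast
    rw [sum_congr rfl (g := fun _ => (#A : ℤ) - D * n), sum_const, nsmul_eq_mul]
    intro f hf
    rw [← card_avoiding hsymm htrans hcard hf]
    congr 1
    refine card_bij' (fun g _ => g (Fin.last n)) (fun v _ => Fin.snoc (α := fun _ => α) f v)
      ?_ ?_ ?_ ?_
    · rintro g hg
      simp only [unrelatedTuples, mem_filter, mem_univ, true_and] at hg ⊢
      obtain ⟨⟨h1, h2⟩, rfl⟩ := hg
      exact ⟨h1 _, fun i => h2 _ _ (Fin.castSucc_ne_last i)⟩
    · intro v hv
      simp only [unrelatedTuples, mem_filter, mem_univ, true_and] at hv hf ⊢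
      refine ⟨⟨fun i => ?_, fun i j hij => ?_⟩, by simp⟩
      · induction i using Fin.lastCases with
        | last => simpa using hv.1
        | cast i => simpa using hf.1 i
      · induction i using Fin.lastCases with
        | last =>
          induction j using Fin.lastCases with
          | last => exact absurd rfl hij
          | cast j => simpa using fun h => hv.2 j (hsymm _ _ h)
        | cast i =>
          induction j using Fin.lastCases with
          | last => simpa using hv.2 i
          | cast j => simpa using hf.2 i j (by simpa using hij)
    · rintro g hg
      simp only [mem_filter] at hg
      rw [← hg.2]
      exact Fin.snoc_init_self g
    · intro v hv
      simp

end Counting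

/-! ### Tuples of residues modulo `2 q` -/

section Residues

open Finset

variable {q : ℕ}

/-- The parity of a residue modulo `2 q`. -/
def parity (q : ℕ) : ZMod (2 * q) →+* ZMod 2 := ZMod.castHom (dvd_mul_right 2 q) _

/-- The condition on a tuple of residues modulo `2 q` corresponding to the hyperplanes of the
dilation by `d` of the roots of type `C`. -/
def AvoidsRoots (q d : ℕ) {n : ℕ} (f : Fin n → ZMod (2 * q)) : Prop :=
  (∀ i, (d : ZMod (2 * q)) * (2 * f i) ≠ 0) ∧
    ∀ i j, i ≠ j → (d : ZMod (2 * q)) * (f i + f j) ≠ 0 ∧ (d : ZMod (2 * q)) * (f i - f j) ≠ 0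

/-- The tuples of residues modulo `2 q` of equal parities avoiding the roots. -/
def avoidingTuples (q d n : ℕ) : Set (Fin n → ZMod (2 * q)) :=
  {f | (∀ i j, parity q (f i) = parity q (f j)) ∧ AvoidsRoots q d f}

open Classical in
/-- The residues modulo `2 q` of parity `p` avoiding the long roots. -/
def avoidingResidues (q d : ℕ) [NeZero q] (p : ZMod 2) : Finset (ZMod (2 * q)) :=
  {u | parity q u = p ∧ (d : ZMod (2 * q)) * (2 * u) ≠ 0}

open Classical in
/-- The residues modulo `2 q` annihilated by `d`. -/
def torsion (q d : ℕ) [NeZero q] : Finset (ZMod (2 * q)) := {u | (d : ZMod (2 * q)) * u = 0}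

open Classical in
-- The class of u is the union of the translates of the torsion by u and by -u. Even torsion keeps
-- both translates in the parity of u, and a common element would force d(2u) = 0.
lemma card_class [NeZero q] {d : ℕ} (hd : ∀ u ∈ torsion q d, parity q u = 0) {p : ZMod 2}
    {u : ZMod (2 * q)} (hu : u ∈ avoidingResidues q d p) :
    #{v ∈ avoidingResidues q d p |
      (d : ZMod (2 * q)) * (u + v) = 0 ∨ (d : ZMod (2 * q)) * (u - v) = 0} =
      2 * #(torsion q d) := by
  have hneg : ∀ p : ZMod 2, -p = p := by decide
  simp only [avoidingResidues, mem_filter, mem_univ, true_and] at hu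
  have h : ({v ∈ avoidingResidues q d p |
      (d : ZMod (2 * q)) * (u + v) = 0 ∨ (d : ZMod (2 * q)) * (u - v) = 0}) =
      (torsion q d).image (fun k => k - u) ∪ (torsion q d).image (fun k => k + u) := by
    ext v
    simp only [mem_filter, mem_union, mem_image]
    constructor
    · rintro ⟨-, h | h⟩
      · exact .inl ⟨u + v, by simpa [torsion] using h, by ring⟩
      · refine .inr ⟨v - u, ?_, by ring⟩
        simp only [torsion, mem_filter, mem_univ, true_and]
        linear_combination -h
    · rintro (⟨k, hk, rfl⟩ | ⟨k, hk, rfl⟩)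
      · have hk' := hd k hk
        simp only [torsion, mem_filter, mem_univ, true_and] at hk
        refine ⟨?_, .inl (by linear_combination hk)⟩
        simp only [avoidingResidues, mem_filter, mem_univ, true_and, map_sub, hk', hu.1]
        refine ⟨by rw [zero_sub, hneg], fun h => hu.2 ?_⟩
        linear_combination 2 * hk - h
      · have hk' := hd k hk
        simp only [torsion, mem_filter, mem_univ, true_and] at hk
        refine ⟨?_, .inr (by linear_combination -hk)⟩
        simp only [avoidingResidues, mem_filter, mem_univ, true_and, map_add, hk', hu.1]
        refine ⟨by rw [zero_add], fun h => hu.2 ?_⟩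
        linear_combination -2 * hk + h
  rw [h, card_union_of_disjoint, card_image_of_injective, card_image_of_injective,
    two_mul #(torsion q d)]
  · exact fun a b h => by simpa using h
  · exact fun a b h => by simpa using h
  · refine disjoint_left.2 fun v hv hw => hu.2 ?_
    simp only [mem_image, torsion, mem_filter, mem_univ, true_and] at hv hw
    obtain ⟨k, hk, rfl⟩ := hv
    obtain ⟨k', hk', h⟩ := hw
    linear_combination hk - hk' + (d : ZMod (2 * q)) * h

/-- The tuples are split by their common parity. The split is disjoint only because n > 0: the empty
tuple would be counted twice. -/
lemma natCard_avoidingTuples [NeZero q] {d : ℕ} (hd : ∀ u ∈ torsion q d, parity q u = 0)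
    {n : ℕ} (hn : 0 < n) :
    (Nat.card (avoidingTuples q d n) : ℤ) =
      ∏ k ∈ range n, ((#(avoidingResidues q d 0) : ℤ) - 2 * #(torsion q d) * k) +
      ∏ k ∈ range n, ((#(avoidingResidues q d 1) : ℤ) - 2 * #(torsion q d) * k) := by
  classical
  let R : ZMod (2 * q) → ZMod (2 * q) → Prop := fun u v =>
    (d : ZMod (2 * q)) * (u + v) = 0 ∨ (d : ZMod (2 * q)) * (u - v) = 0
  have hsymm : ∀ u v, R u v → R v u := by
    rintro u v (h | h)
    · exact .inl (by linear_combination h)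
    · exact .inr (by linear_combination -h)
  have htrans : ∀ u v w, R u v → R v w → R u w := by
    rintro u v w (h | h) (h' | h')
    · exact .inr (by linear_combination h - h')
    · exact .inl (by linear_combination h - h')
    · exact .inl (by linear_combination h + h')
    · exact .inr (by linear_combination h + h')
  have key : ∀ p, (#(unrelatedTuples (avoidingResidues q d p) R n) : ℤ) =
      ∏ k ∈ range n, ((#(avoidingResidues q d p) : ℤ) - 2 * #(torsion q d) * k) := by
    intro p
    rw [card_unrelatedTuples (D := 2 * #(torsion q d)) hsymm htrans
      (fun u hu => by convert card_class hd hu)]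
    push_cast
    rfl
  rw [← key, ← key]
  have hset : avoidingTuples q d n = ((unrelatedTuples (avoidingResidues q d 0) R n ∪
      unrelatedTuples (avoidingResidues q d 1) R n : Finset _) : Set _) := by
    ext f
    simp only [avoidingTuples, AvoidsRoots, Set.mem_ofPred_eq, coe_union, unrelatedTuples,
      coe_filter, mem_univ, true_and, avoidingResidues, mem_filter, R, not_or, Set.mem_union]
    have h01 : ∀ p : ZMod 2, p = 0 ∨ p = 1 := by decide
    constructor
    · rintro ⟨h1, h2, h3⟩
      rcases h01 (parity q (f ⟨0, hn⟩)) with h | h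
      · exact .inl ⟨fun i => ⟨by rw [h1 i ⟨0, hn⟩, h], h2 i⟩, h3⟩
      · exact .inr ⟨fun i => ⟨by rw [h1 i ⟨0, hn⟩, h], h2 i⟩, h3⟩
    · rintro (⟨h1, h2⟩ | ⟨h1, h2⟩) <;>
      exact ⟨fun i j => by rw [(h1 i).1, (h1 j).1], fun i => (h1 i).2, h2⟩
  rw [hset, Nat.card_coe_set_eq, Set.ncard_coe_finset, card_union_of_disjoint]
  · push_cast; rfl
  · refine disjoint_left.2 fun f hf hf' => ?_
    simp only [unrelatedTuples, mem_filter, mem_univ, true_and, avoidingResidues] at hf hf'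
    exact zero_ne_one ((hf.1 ⟨0, hn⟩).1.symm.trans (hf'.1 ⟨0, hn⟩).1)

end Residues

/-! ### Torsion, admissible residues and the resulting product formulas -/

section Residues

open Finset

variable {q : ℕ}

/-- When m divides 2q with quotient r, the kernel of multiplication by m is generated by r. -/
lemma natCast_mul_eq_zero_iff [NeZero q] {m r : ℕ} (h : m * r = 2 * q) (u : ZMod (2 * q)) :
    (m : ZMod (2 * q)) * u = 0 ↔ ∃ k < m, u = ((r * k : ℕ) : ZMod (2 * q)) := by
  have hq : 0 < 2 * q := by have := NeZero.pos q; lia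
  have hm : 0 < m := Nat.pos_of_mul_pos_right (h ▸ hq)
  have hr : 0 < r := Nat.pos_of_mul_pos_left (h ▸ hq)
  constructor
  · intro hu
    rw [← ZMod.natCast_zmod_val u, ← Nat.cast_mul, ZMod.natCast_eq_zero_iff] at hu
    nth_rw 1 [← h] at hu
    obtain ⟨k, hk⟩ := Nat.dvd_of_mul_dvd_mul_left hm hu
    refine ⟨k, ?_, by rw [← hk, ZMod.natCast_zmod_val]⟩
    have := ZMod.val_lt u
    rw [hk] at this
    rw [← h, mul_comm m] at this
    exact lt_of_mul_lt_mul_left this hr.le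
  · rintro ⟨k, -, rfl⟩
    rw [← Nat.cast_mul, ← mul_assoc, h, Nat.cast_mul, ZMod.natCast_self, zero_mul]

lemma natCast_self_ne_zero [NeZero q] : (q : ZMod (2 * q)) ≠ 0 := by
  rw [Ne, ZMod.natCast_eq_zero_iff]
  intro h
  have := Nat.le_of_dvd (NeZero.pos q) h
  have := NeZero.pos q
  lia

lemma natCast_add_self : (q : ZMod (2 * q)) + q = 0 := by
  have := ZMod.natCast_self (2 * q)
  push_cast at this
  linear_combination this

lemma torsion_one [NeZero q] : torsion q 1 = {0} := by
  ext u
  simp [torsion]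

lemma two_mul_eq_zero_iff [NeZero q] (u : ZMod (2 * q)) : 2 * u = 0 ↔ u = 0 ∨ u = q := by
  have := natCast_mul_eq_zero_iff (m := 2) (r := q) rfl u
  rw [Nat.cast_ofNat] at this
  rw [this]
  constructor
  · rintro ⟨k, hk, rfl⟩
    interval_cases k <;> simp
  · rintro (rfl | rfl)
    · exact ⟨0, by simp⟩
    · exact ⟨1, by simp⟩

lemma torsion_two [NeZero q] : torsion q 2 = {0, (q : ZMod (2 * q))} := by
  ext u
  simp [torsion, two_mul_eq_zero_iff]

lemma card_torsion_one [NeZero q] : #(torsion q 1) = 1 := by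
  rw [torsion_one]; rfl

lemma card_torsion_two [NeZero q] : #(torsion q 2) = 2 := by
  rw [torsion_two, card_pair natCast_self_ne_zero.symm]

lemma parity_natCast (n : ℕ) : parity q n = n := map_natCast _ _

lemma parity_torsion_one [NeZero q] : ∀ u ∈ torsion q 1, parity q u = 0 := by
  simp [torsion_one]

lemma parity_torsion_two [NeZero q] (hq : Even q) : ∀ u ∈ torsion q 2, parity q u = 0 := by
  simp only [torsion_two, mem_insert, mem_singleton, forall_eq_or_imp, map_zero, forall_eq,
    true_and, parity_natCast]
  exact (ZMod.natCast_eq_zero_iff_even).2 hq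

open Classical in
-- Translation by 1 exchanges the two parities, so each takes half of the 2q residues.
lemma card_parity [NeZero q] (p : ZMod 2) : #{u : ZMod (2 * q) | parity q u = p} = q := by
  have h01 : ∀ p : ZMod 2, p = 0 ∨ p = 1 := by decide
  have h : #{u : ZMod (2 * q) | parity q u = 0} = #{u : ZMod (2 * q) | parity q u = 1} := by
    refine card_bij' (fun u _ => u + 1) (fun u _ => u - 1) ?_ ?_ ?_ ?_
    · intro u hu
      simp only [mem_filter, mem_univ, true_and] at hu ⊢
      rw [map_add, hu, map_one, zero_add]
    · intro u hu
      simp only [mem_filter, mem_univ, true_and] at hu ⊢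
      rw [map_sub, hu, map_one, sub_self]
    · simp
    · simp
  have h' : #{u : ZMod (2 * q) | parity q u = 0} + #{u : ZMod (2 * q) | parity q u = 1} =
      2 * q := by
    rw [← card_union_of_disjoint]
    · refine Eq.trans (congrArg card ?_) (card_univ.trans (ZMod.card (2 * q)))
      ext u
      simpa using h01 _
    · refine disjoint_left.2 fun u hu hu' => ?_
      simp only [mem_filter, mem_univ, true_and] at hu hu'
      exact zero_ne_one (hu.symm.trans hu')
  rcases h01 p with rfl | rfl <;> lia

open Classical in
lemma card_avoidingResidues [NeZero q] (d : ℕ) (p : ZMod 2) :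
    (#(avoidingResidues q d p) : ℤ) =
      q - #{u : ZMod (2 * q) | (d : ZMod (2 * q)) * (2 * u) = 0 ∧ parity q u = p} := by
  have h := card_filter_add_card_filter_not (s := {u : ZMod (2 * q) | parity q u = p})
    (fun u => (d : ZMod (2 * q)) * (2 * u) = 0)
  rw [card_parity, filter_filter, filter_filter] at h
  have h1 : #(avoidingResidues q d p) =
    #{u : ZMod (2 * q) | parity q u = p ∧ ¬ (d : ZMod (2 * q)) * (2 * u) = 0} := rfl
  simp_rw [and_comm (b := parity q _ = p)]
  rw [h1]
  lia

open Classical in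
lemma filter_two_mul_eq_zero [NeZero q] (p : ZMod 2) :
    ({u : ZMod (2 * q) | ((1 : ℕ) : ZMod (2 * q)) * (2 * u) = 0 ∧ parity q u = p} : Finset _) =
      {u ∈ ({0, (q : ZMod (2 * q))} : Finset (ZMod (2 * q))) | parity q u = p} := by
  ext u
  simp [two_mul_eq_zero_iff]

open Classical in
lemma filter_four_mul_eq_zero {r : ℕ} [NeZero r] [NeZero (2 * r)] (p : ZMod 2) :
    ({u : ZMod (2 * (2 * r)) |
      ((2 : ℕ) : ZMod (2 * (2 * r))) * (2 * u) = 0 ∧ parity (2 * r) u = p} : Finset _) =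
      {u ∈ (range 4).image (fun k : ℕ => ((r * k : ℕ) : ZMod (2 * (2 * r)))) |
        parity (2 * r) u = p} := by
  ext u
  have h := natCast_mul_eq_zero_iff (q := 2 * r) (m := 4) (r := r) (by ring) u
  have h' : ((2 : ℕ) : ZMod (2 * (2 * r))) * (2 * u) = ((4 : ℕ) : ZMod (2 * (2 * r))) * u := by
    push_cast; ring
  simp only [mem_filter, mem_univ, true_and, mem_image, mem_range]
  rw [h', h]
  simp only [eq_comm]

open Classical in
-- With q = 2r the residues killed by 4 are 0, r, 2r, 3r. Their parities depend on that of r, which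
-- is where the cases gcd(4, q) = 2 and gcd(4, q) = 4 separate.
lemma card_filter_four_mul_eq_zero {r : ℕ} [NeZero r] [NeZero (2 * r)] (p : ZMod 2) :
    #{u : ZMod (2 * (2 * r)) |
      ((2 : ℕ) : ZMod (2 * (2 * r))) * (2 * u) = 0 ∧ parity (2 * r) u = p} =
      #{k ∈ range 4 | ((r * k : ℕ) : ZMod 2) = p} := by
  rw [filter_four_mul_eq_zero, filter_image, card_image_of_injOn]
  · simp only [parity_natCast]
  · intro a ha b hb hab
    simp only [coe_filter, mem_range, Set.mem_ofPred_eq] at ha hb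
    have hr := NeZero.pos r
    have : ∀ a < 4, r * a < 2 * (2 * r) := fun a ha => by nlinarith
    rw [ZMod.natCast_eq_natCast_iff', Nat.mod_eq_of_lt (this a ha.1),
      Nat.mod_eq_of_lt (this b hb.1)] at hab
    exact Nat.eq_of_mul_eq_mul_left hr hab

lemma card_avoidingResidues_one_of_odd [NeZero q] (hq : Odd q) (p : ZMod 2) :
    (#(avoidingResidues q 1 p) : ℤ) = q - 1 := by
  have h01 : ∀ p : ZMod 2, p = 0 ∨ p = 1 := by decide
  have h := (ZMod.natCast_eq_one_iff_odd).2 hq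
  rw [card_avoidingResidues, filter_two_mul_eq_zero]
  rcases h01 p with rfl | rfl <;>
  simp [filter_insert, filter_singleton, h]

lemma card_avoidingResidues_one_zero_of_even [NeZero q] (hq : Even q) :
    (#(avoidingResidues q 1 0) : ℤ) = q - 2 := by
  have h := (ZMod.natCast_eq_zero_iff_even).2 hq
  rw [card_avoidingResidues, filter_two_mul_eq_zero]
  simp [filter_insert, filter_singleton, h, card_pair natCast_self_ne_zero.symm]

lemma card_avoidingResidues_one_one_of_even [NeZero q] (hq : Even q) :
    (#(avoidingResidues q 1 1) : ℤ) = q := by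
  have h := (ZMod.natCast_eq_zero_iff_even).2 hq
  rw [card_avoidingResidues, filter_two_mul_eq_zero]
  simp [filter_insert, filter_singleton, h]

lemma card_avoidingResidues_two_of_odd {r : ℕ} [NeZero r] [NeZero (2 * r)] (hr : Odd r)
    (p : ZMod 2) : (#(avoidingResidues (2 * r) 2 p) : ℤ) = 2 * r - 2 := by
  have h := (ZMod.natCast_eq_one_iff_odd).2 hr
  have key : ∀ p : ZMod 2, #{k ∈ range 4 | ((k : ℕ) : ZMod 2) = p} = 2 := by decide
  rw [card_avoidingResidues, card_filter_four_mul_eq_zero]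
  simp only [Nat.cast_mul, h, one_mul, key]
  push_cast
  ring

lemma card_avoidingResidues_two_zero_of_even {r : ℕ} [NeZero r] [NeZero (2 * r)] (hr : Even r) :
    (#(avoidingResidues (2 * r) 2 0) : ℤ) = 2 * r - 4 := by
  have h := (ZMod.natCast_eq_zero_iff_even).2 hr
  rw [card_avoidingResidues, card_filter_four_mul_eq_zero]
  simp [h]

lemma card_avoidingResidues_two_one_of_even {r : ℕ} [NeZero r] [NeZero (2 * r)] (hr : Even r) :
    (#(avoidingResidues (2 * r) 2 1) : ℤ) = 2 * r := by
  have h := (ZMod.natCast_eq_zero_iff_even).2 hr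
  rw [card_avoidingResidues, card_filter_four_mul_eq_zero]
  simp [h]

/-- The first product runs over x - ak with 1 ≤ k ≤ n, the second over 0 ≤ k ≤ n - 1. The factors
with 1 ≤ k ≤ n - 1 are common, leaving (x - an) + x. -/
lemma prod_add_prod (x a : ℤ) {n : ℕ} (hn : 0 < n) :
    (∏ k ∈ range n, (x - a - a * k)) + ∏ k ∈ range n, (x - a * k) =
      (∏ k ∈ Icc 1 (n - 1), (x - a * k)) * (2 * x - a * n) := by
  obtain ⟨n, rfl⟩ : ∃ m, n = m + 1 := ⟨n - 1, by lia⟩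
  have h : ∏ k ∈ Icc 1 (n + 1 - 1), (x - a * k) = ∏ k ∈ range n, (x - a - a * k) := by
    rw [Nat.add_sub_cancel, range_eq_Ico, prod_Ico_eq_prod_range, ← Ico_add_one_right_eq_Icc,
      prod_Ico_eq_prod_range]
    refine prod_congr (by simp) fun k _ => ?_
    push_cast
    ring
  rw [h, prod_range_succ, prod_range_succ' (fun k : ℕ => x - a * (k : ℤ))]
  have h' : ∀ k ∈ range n, x - a * ((k + 1 : ℕ) : ℤ) = x - a - a * k := by
    intro k _
    push_cast
    ring
  rw [prod_congr rfl h']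
  push_cast
  ring

lemma prod_range_eq_prod_Icc (f : ℕ → ℤ) (n : ℕ) :
    ∏ k ∈ range n, f (k + 1) = ∏ k ∈ Icc 1 n, f k := by
  rw [← Ico_add_one_right_eq_Icc, prod_Ico_eq_prod_range]
  simp [add_comm]

lemma natCard_avoidingTuples_one_of_odd (hq0 : 0 < q) (hq : Odd q) {n : ℕ} (hn : 0 < n) :
    (Nat.card (avoidingTuples q 1 n) : ℤ) = 2 * ∏ k ∈ Icc 1 n, ((q : ℤ) - (2 * (k : ℤ) - 1)) := by
  have : NeZero q := ⟨hq0.ne'⟩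
  rw [natCard_avoidingTuples parity_torsion_one hn, card_avoidingResidues_one_of_odd hq,
    card_avoidingResidues_one_of_odd hq, card_torsion_one, ← two_mul,
    ← prod_range_eq_prod_Icc (fun k => (q : ℤ) - (2 * (k : ℤ) - 1))]
  congr 1
  refine prod_congr rfl fun k _ => ?_
  push_cast
  ring

lemma natCard_avoidingTuples_one_of_even (hq0 : 0 < q) (hq : Even q) {n : ℕ} (hn : 0 < n) :
    (Nat.card (avoidingTuples q 1 n) : ℤ) =
      2 * ((∏ k ∈ Icc 1 (n - 1), ((q : ℤ) - 2 * (k : ℤ))) * ((q : ℤ) - n)) := by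
  have : NeZero q := ⟨hq0.ne'⟩
  rw [natCard_avoidingTuples parity_torsion_one hn, card_avoidingResidues_one_zero_of_even hq,
    card_avoidingResidues_one_one_of_even hq, card_torsion_one]
  have := prod_add_prod q 2 hn
  push_cast
  rw [this]
  ring

lemma natCard_avoidingTuples_two_of_odd {r : ℕ} (hr : Odd r) {n : ℕ} (hn : 0 < n) :
    (Nat.card (avoidingTuples (2 * r) 2 n) : ℤ) =
      2 * ∏ k ∈ Icc 1 n, (((2 * r : ℕ) : ℤ) - (4 * (k : ℤ) - 2)) := by
  have : NeZero r := ⟨hr.pos.ne'⟩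
  have : NeZero (2 * r) := ⟨by have := hr.pos; lia⟩
  rw [natCard_avoidingTuples (parity_torsion_two (even_two_mul r)) hn,
    card_avoidingResidues_two_of_odd hr,
    card_avoidingResidues_two_of_odd hr, card_torsion_two, ← two_mul,
    ← prod_range_eq_prod_Icc (fun k => ((2 * r : ℕ) : ℤ) - (4 * (k : ℤ) - 2))]
  congr 1
  refine prod_congr rfl fun k _ => ?_
  push_cast
  ring

/-- Here the two parities offer 2r - 4 and 2r residues with steps of 4. The last factor is written
with the cast of `2 * n` because 2n is the rank ℓ before folding. -/
lemma natCard_avoidingTuples_two_of_even {r : ℕ} (hr0 : 0 < r) (hr : Even r) {n : ℕ}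
    (hn : 0 < n) :
    (Nat.card (avoidingTuples (2 * r) 2 n) : ℤ) =
      2 * ((∏ k ∈ Icc 1 (n - 1), (((2 * r : ℕ) : ℤ) - 4 * (k : ℤ))) *
        (((2 * r : ℕ) : ℤ) - (2 * n : ℕ))) := by
  have : NeZero r := ⟨hr0.ne'⟩
  have : NeZero (2 * r) := ⟨by lia⟩
  rw [natCard_avoidingTuples (parity_torsion_two (even_two_mul r)) hn,
    card_avoidingResidues_two_zero_of_even hr,
    card_avoidingResidues_two_one_of_even hr, card_torsion_two]
  have := prod_add_prod (2 * r) 4 hn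
  push_cast
  rw [this]
  ring

end Residues

/-! ### Orthogonal frames and their coweight lattices -/

section Signed

variable {V : Type*} [NormedAddCommGroup V] {n : ℕ} {ε : Fin n → V}

/-- The members of a family of vectors and their negatives. -/
def signed (ε : Fin n → V) : Set V := {v | ∃ i, v = ε i ∨ v = -ε i}

/-- The vectors `± ε i ± ε j` (`i ≠ j`) and `± 2 ε i`. -/
def frameRoots (ε : Fin n → V) : Set V :=
  {v | v ≠ 0 ∧ ∃ a ∈ signed ε, ∃ b ∈ signed ε, v = a + b}

lemma mem_signed (ε : Fin n → V) (i : Fin n) : ε i ∈ signed ε := ⟨i, .inl rfl⟩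

lemma neg_mem_signed (ε : Fin n → V) (i : Fin n) : -ε i ∈ signed ε := ⟨i, .inr rfl⟩

/-- The roots of a frame, up to sign. -/
lemma eq_of_mem_frameRoots {v : V} (hv : v ∈ frameRoots ε) :
    ∃ i j, v = ε i + ε j ∨ v = -(ε i + ε j) ∨ (i ≠ j ∧ v = ε i - ε j) := by
  obtain ⟨h0, _, ⟨i, rfl | rfl⟩, _, ⟨j, rfl | rfl⟩, rfl⟩ := hv
  · exact ⟨i, j, .inl rfl⟩
  · refine ⟨i, j, .inr (.inr ⟨?_, (sub_eq_add_neg _ _).symm⟩)⟩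
    rintro rfl
    exact h0 (add_neg_cancel _)
  · refine ⟨j, i, .inr (.inr ⟨?_, neg_add_eq_sub _ _⟩)⟩
    rintro rfl
    exact h0 (neg_add_cancel _)
  · exact ⟨i, j, .inr (.inl (neg_add _ _).symm)⟩

end Signed

section Frames

variable {V : Type*} [NormedAddCommGroup V] [InnerProductSpace ℝ V] {n : ℕ}

/-- An orthogonal basis all of whose members have squared norm `c`. -/
structure IsFrame (ε : Fin n → V) (c : ℝ) : Prop where
  pos : 0 < c
  inner_eq : ∀ i j, ⟪ε i, ε j⟫ = if i = j then c else 0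
  span_eq : Submodule.span ℝ (Set.range ε) = ⊤

/-- The integers `y i` are twice the inner products of `x` with the members of the frame. -/
def HasCoords (ε : Fin n → V) (x : V) (y : Fin n → ℤ) : Prop := ∀ i, 2 * ⟪ε i, x⟫ = y i

variable {ε : Fin n → V} {c : ℝ}

namespace IsFrame

lemma inner_self (h : IsFrame ε c) (i : Fin n) : ⟪ε i, ε i⟫ = c := by
  rw [h.inner_eq, if_pos rfl]

lemma ne_zero (h : IsFrame ε c) (i : Fin n) : ε i ≠ 0 := by
  intro h0
  have := h.inner_self i
  rw [h0, inner_zero_left] at this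
  exact h.pos.ne this

lemma inner_ne (h : IsFrame ε c) {i j : Fin n} (hij : i ≠ j) : ⟪ε i, ε j⟫ = 0 := by
  simp [h.inner_eq, hij]

lemma ext_inner (h : IsFrame ε c) {x y : V} (hxy : ∀ i, ⟪ε i, x⟫ = ⟪ε i, y⟫) : x = y := by
  refine ext_inner_left ℝ fun v => ?_
  have hv : v ∈ Submodule.span ℝ (Set.range ε) := h.span_eq ▸ Submodule.mem_top
  induction hv using Submodule.span_induction with
  | mem v hv => obtain ⟨i, rfl⟩ := hv; exact hxy i
  | zero => simp
  | add u v _ _ hu hv => rw [inner_add_left, inner_add_left, hu, hv]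
  | smul a v _ hv => rw [inner_smul_left, inner_smul_left, hv]

lemma exists_inner_eq (h : IsFrame ε c) (z : Fin n → ℝ) : ∃ x : V, ∀ i, ⟪ε i, x⟫ = z i := by
  refine ⟨∑ j, (z j / c) • ε j, fun i => ?_⟩
  rw [inner_sum, Finset.sum_eq_single i]
  · rw [inner_smul_right, h.inner_self, div_mul_cancel₀ _ h.pos.ne']
  · intro j _ hj
    rw [inner_smul_right, h.inner_ne hj.symm, mul_zero]
  · simp

lemma sub_ne_zero (h : IsFrame ε c) {i j : Fin n} (hij : i ≠ j) : ε i - ε j ≠ 0 := by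
  intro h0
  have := congrArg (fun v => ⟪ε i, v⟫) h0
  simp only [inner_sub_right, h.inner_self, h.inner_ne hij, inner_zero_right, sub_zero] at this
  exact h.pos.ne' this

lemma add_ne_zero (h : IsFrame ε c) (i j : Fin n) : ε i + ε j ≠ 0 := by
  intro h0
  have := congrArg (fun v => ⟪ε i, v⟫) h0
  simp only [inner_add_right, h.inner_eq, inner_zero_right, if_true] at this
  have := h.pos
  split_ifs at * <;> linarith

lemma add_mem_frameRoots (h : IsFrame ε c) (i j : Fin n) : ε i + ε j ∈ frameRoots ε :=
  ⟨h.add_ne_zero i j, _, mem_signed ε i, _, mem_signed ε j, rfl⟩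

lemma sub_mem_frameRoots (h : IsFrame ε c) {i j : Fin n} (hij : i ≠ j) :
    ε i - ε j ∈ frameRoots ε :=
  ⟨h.sub_ne_zero hij, _, mem_signed ε i, _, neg_mem_signed ε j, sub_eq_add_neg _ _⟩

end IsFrame

lemma HasCoords.mem_coweightLattice {x : V} {y : Fin n → ℤ} (hx : HasCoords ε x y)
    (hy : ∀ i j, (2 : ℤ) ∣ y i - y j) : x ∈ coweightLattice (frameRoots ε) := by
  intro v hv
  obtain ⟨i, j, h⟩ := eq_of_mem_frameRoots hv
  obtain ⟨k, hk⟩ := hy i j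
  have hi := hx i
  have hj := hx j
  have hk' : (y i : ℝ) - y j = 2 * k := by exact_mod_cast hk
  rcases h with rfl | rfl | ⟨-, rfl⟩
  · exact ⟨y j + k, by push_cast; rw [inner_add_left]; linarith⟩
  · exact ⟨-(y j + k), by push_cast; rw [inner_neg_left, inner_add_left]; linarith⟩
  · exact ⟨k, by rw [inner_sub_left]; linarith⟩

/-- Integrality on 2ε_i makes the doubled coordinates integers; integrality on ε_i - ε_j makes them
congruent modulo 2. -/
lemma IsFrame.exists_hasCoords (h : IsFrame ε c) {x : V}
    (hx : x ∈ coweightLattice (frameRoots ε)) :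
    ∃ y : Fin n → ℤ, HasCoords ε x y ∧ ∀ i j, (2 : ℤ) ∣ y i - y j := by
  choose y hy using fun i => hx _ (h.add_mem_frameRoots i i)
  have hy' : HasCoords ε x y := fun i => by rw [← hy, inner_add_left]; ring
  refine ⟨y, hy', fun i j => ?_⟩
  rcases eq_or_ne i j with rfl | hij
  · simp
  · obtain ⟨k, hk⟩ := hx _ (h.sub_mem_frameRoots hij)
    refine ⟨k, ?_⟩
    have hi := hy' i
    have hj := hy' j
    rw [inner_sub_left] at hk
    have : (y i : ℝ) - y j = 2 * k := by linarith
    exact_mod_cast this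

lemma intCast_natCast_mul_eq_zero_iff {q d : ℕ} {a : ℤ} :
    (d : ZMod (2 * q)) * (a : ZMod (2 * q)) = 0 ↔ ∃ k : ℤ, (d : ℝ) * a = 2 * (q * k) := by
  rw [← Int.cast_natCast (R := ZMod (2 * q)) d, ← Int.cast_mul, ZMod.intCast_zmod_eq_zero_iff_dvd]
  refine exists_congr fun k => ?_
  rw [← Int.cast_inj (α := ℝ)]
  push_cast
  rw [mul_assoc]

/-- Coordinates are twice the inner products, so a condition modulo q on (β, x) becomes one modulo
2q on y. Roots matter only up to sign. -/
lemma IsFrame.avoidsRoots_iff (h : IsFrame ε c) {q d : ℕ} {x : V} {y : Fin n → ℤ}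
    (hx : HasCoords ε x y) :
    AvoidsRoots q d (fun i => (y i : ZMod (2 * q))) ↔
      ∀ β ∈ dilate d (frameRoots ε), ∀ k : ℤ, ⟪β, x⟫ ≠ (q : ℝ) * k := by
  have key : ∀ v : V, ∀ a : ℤ, 2 * ⟪v, x⟫ = a →
      ((d : ZMod (2 * q)) * (a : ZMod (2 * q)) ≠ 0 ↔ ∀ k : ℤ, ⟪(d : ℝ) • v, x⟫ ≠ (q : ℝ) * k) := by
    intro v a ha
    rw [Ne, intCast_natCast_mul_eq_zero_iff, not_exists]
    refine forall_congr' fun k => not_congr ?_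
    rw [← ha, inner_smul_left, RCLike.conj_to_real]
    constructor <;> intro <;> linarith
  have hadd : ∀ i j, 2 * ⟪ε i + ε j, x⟫ = ((y i + y j : ℤ) : ℝ) := by
    intro i j
    rw [inner_add_left, mul_add, hx, hx]; push_cast; rfl
  have hsub : ∀ i j, 2 * ⟪ε i - ε j, x⟫ = ((y i - y j : ℤ) : ℝ) := by
    intro i j
    rw [inner_sub_left, mul_sub, hx, hx]; push_cast; rfl
  have hadd' := fun i j => key _ _ (hadd i j)
  have hsub' := fun i j => key _ _ (hsub i j)
  push_cast at hadd' hsub'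
  constructor
  · rintro ⟨h1, h2⟩ _ ⟨v, hv, rfl⟩
    have hA : ∀ i j, ∀ k : ℤ, ⟪(d : ℝ) • (ε i + ε j), x⟫ ≠ (q : ℝ) * k := by
      intro i j
      rw [← hadd']
      rcases eq_or_ne i j with rfl | hij
      · simpa only [two_mul] using h1 i
      · exact (h2 i j hij).1
    obtain ⟨i, j, rfl | rfl | ⟨hij, rfl⟩⟩ := eq_of_mem_frameRoots hv
    · exact hA i j
    · intro k hk
      refine hA i j (-k) ?_
      push_cast
      rw [mul_neg, ← hk]
      simp only [smul_neg, inner_neg_left, neg_neg]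
    · exact (hsub' i j).1 (h2 i j hij).2
  · intro hβ
    have hβ' : ∀ v ∈ frameRoots ε, ∀ k : ℤ, ⟪(d : ℝ) • v, x⟫ ≠ (q : ℝ) * k :=
      fun v hv => hβ _ ⟨v, hv, rfl⟩
    refine ⟨fun i => ?_, fun i j hij => ⟨(hadd' i j).2 (hβ' _ (h.add_mem_frameRoots i j)),
      (hsub' i j).2 (hβ' _ (h.sub_mem_frameRoots hij))⟩⟩
    have := (hadd' i i).2 (hβ' _ (h.add_mem_frameRoots i i))
    rwa [← two_mul (y i : ZMod (2 * q))] at this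

/-- If x' - x = qz with z a coweight, then y' - y = qt where all t_i have the same parity. Even t
vanishes modulo 2q after multiplication by q, odd t leaves the constant q. -/
lemma IsFrame.mk_eq_mk_iff (h : IsFrame ε c) {q : ℕ}
    {x x' : coweightLattice (frameRoots ε)} {y y' : Fin n → ℤ} (hx : HasCoords ε x y)
    (hx' : HasCoords ε x' y') :
    (QuotientAddGroup.mk x : ModQ (coweightLattice (frameRoots ε)) q) = QuotientAddGroup.mk x' ↔
      (∀ i, (y' i : ZMod (2 * q)) = y i) ∨ ∀ i, (y' i : ZMod (2 * q)) = y i + q := by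
  have hmod : ∀ a b : ℤ, (a : ZMod (2 * q)) = b ↔ ∃ k : ℤ, a - b = 2 * q * k := by
    intro a b
    rw [← sub_eq_zero, ← Int.cast_sub, ZMod.intCast_zmod_eq_zero_iff_dvd]
    push_cast
    rfl
  have hmod' : ∀ a b : ℤ, (a : ZMod (2 * q)) = b + q ↔ ∃ k : ℤ, a - b = q * (2 * k + 1) := by
    intro a b
    have := hmod a (b + q)
    push_cast at this
    rw [this]
    exact exists_congr fun k => ⟨fun h => by linarith, fun h => by linarith⟩
  rw [QuotientAddGroup.eq]
  constructor
  · rintro ⟨z, hz⟩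
    obtain ⟨t, ht, ht2⟩ := h.exists_hasCoords z.2
    have hyt : ∀ i, y' i - y i = q * t i := by
      intro i
      have hz' : (x' : V) - x = (q : ℝ) • (z : V) := by
        have := congrArg (Subtype.val) hz
        simp only [nsmulAddMonoidHom_apply, AddSubgroup.coe_nsmul, AddSubgroup.coe_add,
          AddSubgroup.coe_neg] at this
        rw [Nat.cast_smul_eq_nsmul, this]
        abel
      have h3 := congrArg (fun v => ⟪ε i, v⟫) hz'
      simp only [inner_sub_right, inner_smul_right] at h3
      have h1 := hx i
      have h1' := hx' i
      have h2 := ht i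
      have : (y' i : ℝ) - y i = q * t i := by rw [← h1, ← h1', ← h2]; linarith
      exact_mod_cast this
    -- The t i are congruent modulo 2, so one even entry makes all of them even.
    by_cases hpar : ∃ i, Even (t i)
    · obtain ⟨i₀, k₀, hk₀⟩ := hpar
      refine .inl fun i => (hmod _ _).2 ?_
      obtain ⟨k, hk⟩ := ht2 i i₀
      refine ⟨k + k₀, ?_⟩
      rw [hyt, show t i = 2 * (k + k₀) by lia]
      ring
    · refine .inr fun i => (hmod' _ _).2 ?_
      obtain ⟨k, hk⟩ := Int.not_even_iff_odd.1 fun hi => hpar ⟨i, hi⟩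
      exact ⟨k, by rw [hyt, hk]⟩
  · intro hyy
    obtain ⟨t, ht, ht2⟩ : ∃ t : Fin n → ℤ, (∀ i, y' i - y i = q * t i) ∧
        ∀ i j, (2 : ℤ) ∣ t i - t j := by
      rcases hyy with hyy | hyy
      · choose t ht using fun i => (hmod _ _).1 (hyy i)
        exact ⟨fun i => 2 * t i, fun i => by rw [ht]; ring, fun i j => ⟨t i - t j, by ring⟩⟩
      · choose t ht using fun i => (hmod' _ _).1 (hyy i)
        exact ⟨fun i => 2 * t i + 1, ht, fun i j => ⟨t i - t j, by ring⟩⟩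
    obtain ⟨z, hz⟩ := h.exists_inner_eq (fun i => (t i : ℝ) / 2)
    have hz' : HasCoords ε z t := fun i => by rw [hz]; ring
    refine ⟨⟨z, hz'.mem_coweightLattice ht2⟩, Subtype.ext ?_⟩
    simp only [nsmulAddMonoidHom_apply, AddSubgroup.coe_nsmul, AddSubgroup.coe_add,
      AddSubgroup.coe_neg]
    refine h.ext_inner fun i => ?_
    rw [← Nat.cast_smul_eq_nsmul ℝ, inner_smul_right, inner_add_right, inner_neg_right]
    have h1 := hx i
    have h1' := hx' i
    have h2 := hz' i
    have h3 : (y' i : ℝ) - y i = q * t i := by exact_mod_cast ht i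
    rw [← h1, ← h1', ← h2] at h3
    linarith

/-- The classes modulo `q` of the coweights whose coordinates modulo `2 q` lie in `Y`. -/
def classesOf (ε : Fin n → V) (q : ℕ) (Y : Set (Fin n → ZMod (2 * q))) :
    Set (ModQ (coweightLattice (frameRoots ε)) q) :=
  {t | ∃ (x : coweightLattice (frameRoots ε)) (y : Fin n → ℤ), HasCoords ε x y ∧
    QuotientAddGroup.mk x = t ∧ (fun i => (y i : ZMod (2 * q))) ∈ Y}

lemma exists_lift {q : ℕ} [NeZero q] {f : Fin n → ZMod (2 * q)}
    (hf : ∀ i j, parity q (f i) = parity q (f j)) :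
    ∃ y : Fin n → ℤ, (∀ i, (y i : ZMod (2 * q)) = f i) ∧ ∀ i j, (2 : ℤ) ∣ y i - y j := by
  refine ⟨fun i => (f i).val, fun i => by simp, fun i j => ?_⟩
  have hi : ∀ i, parity q (f i) = (((f i).val : ℤ) : ZMod 2) := by
    intro i
    conv_lhs => rw [← ZMod.natCast_zmod_val (f i), parity_natCast]
    simp
  have h := hf i j
  rw [hi, hi, ← sub_eq_zero, ← Int.cast_sub, ZMod.intCast_zmod_eq_zero_iff_dvd, Nat.cast_ofNat] at h
  exact h

lemma IsFrame.exists_coweight (h : IsFrame ε c) {q : ℕ} [NeZero q] {f : Fin n → ZMod (2 * q)}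
    (hf : ∀ i j, parity q (f i) = parity q (f j)) :
    ∃ (x : coweightLattice (frameRoots ε)) (y : Fin n → ℤ), HasCoords ε x y ∧
      (fun i => (y i : ZMod (2 * q))) = f := by
  obtain ⟨y, hy, hy2⟩ := exists_lift hf
  obtain ⟨x, hx⟩ := h.exists_inner_eq (fun i => (y i : ℝ) / 2)
  have hx' : HasCoords ε x y := fun i => by rw [hx]; ring
  exact ⟨⟨x, hx'.mem_coweightLattice hy2⟩, y, hx', funext hy⟩

/-- Each class has exactly two coordinate tuples modulo 2q, exchanged by the shift by q; a Boolean
records which of them is meant. -/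
lemma IsFrame.two_mul_natCard_classesOf (h : IsFrame ε c) (hn : 0 < n) {q : ℕ} [NeZero q]
    {Y : Set (Fin n → ZMod (2 * q))}
    (hY : ∀ f ∈ Y, ∀ i j, parity q (f i) = parity q (f j))
    (hYq : ∀ f ∈ Y, (fun i => f i + q) ∈ Y) :
    2 * Nat.card (classesOf ε q Y) = Nat.card Y := by
  choose x y hxy hmk hy using fun t : classesOf ε q Y => t.2
  let F : classesOf ε q Y × Bool → Y := fun p =>
    bif p.2 then ⟨_, hYq _ (hy p.1)⟩ else ⟨_, hy p.1⟩
  have hF : Function.Bijective F := by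
    constructor
    · rintro ⟨t, b⟩ ⟨t', b'⟩ htt
      have ht : t = t' := by
        refine Subtype.ext ?_
        rw [← hmk t, ← hmk t', h.mk_eq_mk_iff (hxy t) (hxy t')]
        have h1 := fun i => congrFun (congrArg Subtype.val htt) i
        cases b <;> cases b' <;> simp only [F, cond_true, cond_false] at h1
        · exact .inl fun i => (h1 i).symm
        · refine .inr fun i => ?_
          rw [h1 i, add_assoc, natCast_add_self, add_zero]
        · exact .inr fun i => (h1 i).symm
        · exact .inl fun i => (add_right_cancel (h1 i)).symm
      subst ht
      -- The two tuples of one class differ already in entry 0, since q ≠ 0 modulo 2q; this needs n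
      -- > 0.
      have h1 := congrFun (congrArg Subtype.val htt) ⟨0, hn⟩
      have hq := natCast_self_ne_zero (q := q)
      cases b <;> cases b' <;> simp [F, hq] at h1 ⊢
    · rintro ⟨f, hf⟩
      obtain ⟨x', y', hx', hy'⟩ := h.exists_coweight (hY f hf)
      let t : classesOf ε q Y := ⟨QuotientAddGroup.mk x', x', y', hx', rfl, hy'.symm ▸ hf⟩
      rcases (h.mk_eq_mk_iff (hxy t) hx').1 (hmk t) with h1 | h1
      · refine ⟨(t, false), Subtype.ext (?_)⟩
        refine Eq.trans (funext fun i => ?_) hy'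
        exact (h1 i).symm
      · refine ⟨(t, true), Subtype.ext (?_)⟩
        refine Eq.trans (funext fun i => ?_) hy'
        exact (h1 i).symm
  rw [← Nat.card_congr (Equiv.ofBijective F hF), Nat.card_prod, mul_comm]
  simp

/-- The shift changes sums by 2q = 0 and leaves differences alone. -/
lemma AvoidsRoots.add_natCast {q d : ℕ} {f : Fin n → ZMod (2 * q)} (hf : AvoidsRoots q d f) :
    AvoidsRoots q d (fun i => f i + q) := by
  have hq := natCast_add_self (q := q)
  refine ⟨fun i h => hf.1 i ?_, fun i j hij => ⟨fun h => (hf.2 i j hij).1 ?_,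
    fun h => (hf.2 i j hij).2 ?_⟩⟩
  · linear_combination h - d * hq
  · linear_combination h - d * hq
  · linear_combination h

lemma add_natCast_mem_avoidingTuples {q d : ℕ} {f : Fin n → ZMod (2 * q)}
    (hf : f ∈ avoidingTuples q d n) : (fun i => f i + (q : ZMod (2 * q))) ∈ avoidingTuples q d n :=
  ⟨fun i j => by simp only [map_add, hf.1 i j], hf.2.add_natCast⟩

lemma HasCoords.parity_eq {q : ℕ} {y : Fin n → ℤ} (hy : ∀ i j, (2 : ℤ) ∣ y i - y j)
    (i j : Fin n) : parity q (y i : ZMod (2 * q)) = parity q (y j : ZMod (2 * q)) := by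
  rw [map_intCast, map_intCast, ← sub_eq_zero, ← Int.cast_sub, ZMod.intCast_zmod_eq_zero_iff_dvd]
  exact_mod_cast hy i j

lemma IsFrame.modComplement_dilate (h : IsFrame ε c) (q d : ℕ) :
    modComplement (dilate d (frameRoots ε)) (coweightLattice (frameRoots ε)) q =
      classesOf ε q (avoidingTuples q d n) := by
  ext t
  constructor
  · rintro ⟨x, hx, rfl⟩
    obtain ⟨y, hy, hy2⟩ := h.exists_hasCoords x.2
    exact ⟨x, y, hy, rfl, HasCoords.parity_eq hy2, (h.avoidsRoots_iff hy).2 hx⟩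
  · rintro ⟨x, y, hy, rfl, -, hy'⟩
    exact ⟨x, (h.avoidsRoots_iff hy).1 hy', rfl⟩

lemma IsFrame.two_mul_charQuasi (h : IsFrame ε c) (hn : 0 < n) {q : ℕ} (hq : 0 < q) (d : ℕ) :
    2 * charQuasi (dilate d (frameRoots ε)) (coweightLattice (frameRoots ε)) q =
      Nat.card (avoidingTuples q d n) := by
  have : NeZero q := ⟨hq.ne'⟩
  rw [charQuasi, h.modComplement_dilate]
  exact h.two_mul_natCard_classesOf hn (fun f hf => hf.1)
    fun f hf => add_natCast_mem_avoidingTuples hf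

lemma dilate_one (Φ : Set V) : dilate ((1 : ℕ) : ℝ) Φ = Φ := by simp [dilate]

end Frames

/-! ### The root system of a frame -/

section RootSystem

variable {V : Type*} [NormedAddCommGroup V] {n : ℕ} {ε : Fin n → V}

lemma neg_mem_of_mem_signed {a : V} (ha : a ∈ signed ε) : -a ∈ signed ε := by
  obtain ⟨i, rfl | rfl⟩ := ha
  · exact neg_mem_signed ε i
  · rw [neg_neg]; exact mem_signed ε i

lemma finite_signed : (signed ε).Finite := by
  refine ((Set.finite_range ε).union (Set.finite_range fun i => -ε i)).subset ?_
  rintro _ ⟨i, rfl | rfl⟩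
  · exact .inl ⟨i, rfl⟩
  · exact .inr ⟨i, rfl⟩

lemma finite_frameRoots : (frameRoots ε).Finite := by
  refine (Set.Finite.image2 (· + ·) (finite_signed (ε := ε)) (finite_signed (ε := ε))).subset ?_
  rintro _ ⟨-, a, ha, b, hb, rfl⟩
  exact ⟨a, ha, b, hb, rfl⟩

/-- The simple roots `ε i - ε (i + 1)` and `2 ε (n - 1)` of a frame. -/
def frameSimple (ε : Fin n → V) (i : Fin n) : V :=
  if h : i.1 + 1 < n then ε i - ε ⟨i.1 + 1, h⟩ else ε i + ε i

lemma frameSimple_of_lt (ε : Fin n → V) {i : Fin n} (h : i.1 + 1 < n) :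
    frameSimple ε i = ε i - ε ⟨i.1 + 1, h⟩ := dif_pos h

lemma frameSimple_of_not_lt (ε : Fin n → V) {i : Fin n} (h : ¬ i.1 + 1 < n) :
    frameSimple ε i = ε i + ε i := dif_neg h

/-- Telescoping along the simple roots ε_i - ε_{i+1}. -/
lemma sub_mem_closure_frameSimple (i : Fin n) :
    ∀ k (hk : k < n), i.1 ≤ k →
      ε i - ε ⟨k, hk⟩ ∈ AddSubmonoid.closure (Set.range (frameSimple ε)) := by
  intro k hk hik
  induction k, hik using Nat.le_induction with
  | base => simp
  | succ k hik ih =>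
    have h1 : frameSimple ε ⟨k, by lia⟩ = ε ⟨k, by lia⟩ - ε ⟨k + 1, hk⟩ := frameSimple_of_lt ε hk
    have h2 := add_mem (ih (by lia))
      (AddSubmonoid.subset_closure ⟨⟨k, by lia⟩, h1⟩)
    rwa [sub_add_sub_cancel] at h2

lemma add_self_mem_closure_frameSimple (i : Fin n) :
    ε i + ε i ∈ AddSubmonoid.closure (Set.range (frameSimple ε)) := by
  have hi := i.2
  have h1 : frameSimple ε ⟨n - 1, by lia⟩ = ε ⟨n - 1, by lia⟩ + ε ⟨n - 1, by lia⟩ :=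
    frameSimple_of_not_lt ε (by simp only; lia)
  have h2 := sub_mem_closure_frameSimple (ε := ε) i (n - 1) (by lia) (by lia)
  have h3 := add_mem (add_mem h2 h2) (AddSubmonoid.subset_closure ⟨⟨n - 1, by lia⟩, h1⟩)
  convert h3 using 1
  abel

/-- For i ≤ j, ε_i + ε_j = (ε_i - ε_j) + 2ε_j is a sum of two vectors already known to be positive
combinations. -/
lemma mem_or_neg_mem_closure_frameSimple {v : V} (hv : v ∈ frameRoots ε) :
    v ∈ AddSubmonoid.closure (Set.range (frameSimple ε)) ∨
      -v ∈ AddSubmonoid.closure (Set.range (frameSimple ε)) := by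
  have hadd : ∀ i j, ε i + ε j ∈ AddSubmonoid.closure (Set.range (frameSimple ε)) := by
    intro i j
    wlog hij : i.1 ≤ j.1 generalizing i j
    · rw [add_comm]
      exact this j i (by lia)
    have := add_mem (sub_mem_closure_frameSimple (ε := ε) i j.1 j.2 hij)
      (add_self_mem_closure_frameSimple (ε := ε) j)
    convert this using 1
    abel
  obtain ⟨i, j, rfl | rfl | ⟨-, rfl⟩⟩ := eq_of_mem_frameRoots hv
  · exact .inl (hadd i j)
  · exact .inr (by rw [neg_neg]; exact hadd i j)
  · rcases le_total i.1 j.1 with hij | hij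
    · exact .inl (sub_mem_closure_frameSimple (ε := ε) i j.1 j.2 hij)
    · exact .inr (by rw [neg_sub]; exact sub_mem_closure_frameSimple (ε := ε) j i.1 i.2 hij)

end RootSystem

section RootSystem

variable {V : Type*} [NormedAddCommGroup V] [InnerProductSpace ℝ V] {n : ℕ}
  {ε : Fin n → V} {c : ℝ}

namespace IsFrame

lemma inner_self_of_mem_signed (h : IsFrame ε c) {a : V} (ha : a ∈ signed ε) : ⟪a, a⟫ = c := by
  obtain ⟨i, rfl | rfl⟩ := ha
  · exact h.inner_self i
  · rw [inner_neg_neg, h.inner_self i]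

lemma eq_or_eq_neg_or_inner_eq_zero (h : IsFrame ε c) {a b : V} (ha : a ∈ signed ε)
    (hb : b ∈ signed ε) : a = b ∨ a = -b ∨ ⟪a, b⟫ = 0 := by
  obtain ⟨i, hi⟩ := ha
  obtain ⟨j, hj⟩ := hb
  rcases eq_or_ne i j with rfl | hij
  · rcases hi with rfl | rfl <;> rcases hj with rfl | rfl <;> simp
  · have := h.inner_ne hij
    rcases hi with rfl | rfl <;> rcases hj with rfl | rfl <;>
    simp [inner_neg_left, inner_neg_right, this]

lemma mem_frameRoots_cases (h : IsFrame ε c) {v : V} (hv : v ∈ frameRoots ε) :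
    (∃ a ∈ signed ε, v = (2 : ℝ) • a) ∨
      ∃ a ∈ signed ε, ∃ b ∈ signed ε, ⟪a, b⟫ = 0 ∧ v = a + b := by
  obtain ⟨h0, a, ha, b, hb, rfl⟩ := hv
  rcases h.eq_or_eq_neg_or_inner_eq_zero ha hb with rfl | rfl | hab
  · exact .inl ⟨a, ha, (two_smul ℝ a).symm⟩
  · exact absurd (neg_add_cancel _) h0
  · exact .inr ⟨a, ha, b, hb, hab, rfl⟩

lemma inner_add_self (h : IsFrame ε c) {a b : V} (ha : a ∈ signed ε) (hb : b ∈ signed ε)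
    (hab : ⟪a, b⟫ = 0) : ⟪a + b, a + b⟫ = 2 * c := by
  rw [inner_add_left, inner_add_right, inner_add_right, real_inner_comm a b, hab,
    h.inner_self_of_mem_signed ha, h.inner_self_of_mem_signed hb]
  ring

/-- A reflection in 2a negates a; one in a + b exchanges a and -b; all other signed frame vectors
are fixed. Since roots are sums of two signed vectors, integrality and stability of the roots follow
from this by linearity. -/
lemma reflection_mem_signed (h : IsFrame ε c) {u v : V} (hv : v ∈ frameRoots ε)
    (hu : u ∈ signed ε) :
    (∃ z : ℤ, 2 * ⟪v, u⟫ / ⟪v, v⟫ = z) ∧ u - (2 * ⟪v, u⟫ / ⟪v, v⟫) • v ∈ signed ε := by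
  have hc := h.pos.ne'
  have hu' := h.inner_self_of_mem_signed hu
  rcases h.mem_frameRoots_cases hv with ⟨a, ha, rfl⟩ | ⟨a, ha, b, hb, hab, rfl⟩
  · have haa := h.inner_self_of_mem_signed ha
    rw [inner_smul_left, inner_smul_left, inner_smul_right, RCLike.conj_to_real, haa]
    rcases h.eq_or_eq_neg_or_inner_eq_zero hu ha with rfl | rfl | hua
    · rw [haa, show 2 * (2 * c) / (2 * (2 * c)) = 1 by field_simp]
      refine ⟨⟨1, by simp⟩, ?_⟩
      convert neg_mem_of_mem_signed ha using 1
      module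
    · rw [inner_neg_right, haa, show 2 * (2 * -c) / (2 * (2 * c)) = -1 by field_simp]
      refine ⟨⟨-1, by simp⟩, ?_⟩
      convert ha using 1
      module
    · rw [real_inner_comm, hua]
      exact ⟨⟨0, by simp⟩, by simpa using hu⟩
  · have haa := h.inner_self_of_mem_signed ha
    have hbb := h.inner_self_of_mem_signed hb
    have hba : ⟪b, a⟫ = 0 := by rw [real_inner_comm, hab]
    rw [h.inner_add_self ha hb hab, inner_add_left]
    rcases h.eq_or_eq_neg_or_inner_eq_zero hu ha with rfl | rfl | hua
    · rw [haa, hba, show 2 * (c + 0) / (2 * c) = 1 by field_simp; ring]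
      refine ⟨⟨1, by simp⟩, ?_⟩
      convert neg_mem_of_mem_signed hb using 1
      module
    · rw [inner_neg_right, inner_neg_right, haa, hba,
        show 2 * (-c + -0) / (2 * c) = -1 by field_simp; ring]
      refine ⟨⟨-1, by simp⟩, ?_⟩
      convert hb using 1
      module
    · rw [real_inner_comm u a, hua]
      rcases h.eq_or_eq_neg_or_inner_eq_zero hu hb with rfl | rfl | hub
      · rw [hbb, show 2 * (0 + c) / (2 * c) = 1 by field_simp; ring]
        refine ⟨⟨1, by simp⟩, ?_⟩
        convert neg_mem_of_mem_signed ha using 1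
        module
      · rw [inner_neg_right, hbb, show 2 * (0 + -c) / (2 * c) = -1 by field_simp; ring]
        refine ⟨⟨-1, by simp⟩, ?_⟩
        convert ha using 1
        module
      · rw [real_inner_comm u b, hub]
        exact ⟨⟨0, by simp⟩, by simpa using hu⟩

lemma exists_int_eq (h : IsFrame ε c) {w v : V} (hv : v ∈ frameRoots ε)
    (hw : w ∈ frameRoots ε) : ∃ z : ℤ, 2 * ⟪v, w⟫ / ⟪v, v⟫ = z := by
  obtain ⟨-, a, ha, b, hb, rfl⟩ := hw
  obtain ⟨z, hz⟩ := (h.reflection_mem_signed hv ha).1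
  obtain ⟨z', hz'⟩ := (h.reflection_mem_signed hv hb).1
  exact ⟨z + z', by push_cast; rw [← hz, ← hz', inner_add_right]; ring⟩

lemma reflection_mem_frameRoots (h : IsFrame ε c) {w v : V} (hv : v ∈ frameRoots ε)
    (hw : w ∈ frameRoots ε) : w - (2 * ⟪v, w⟫ / ⟪v, v⟫) • v ∈ frameRoots ε := by
  have hvv : ⟪v, v⟫ ≠ 0 := by simpa using hv.1
  refine ⟨fun h0 => hw.1 ?_, ?_⟩
  · have h1 := congrArg (fun x => ⟪v, x⟫) h0
    simp only [inner_sub_right, inner_smul_right, inner_zero_right] at h1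
    have h2 : ⟪v, w⟫ = 0 := by
      field_simp at h1
      linarith
    simpa [h2] using h0
  · obtain ⟨-, a, ha, b, hb, rfl⟩ := hw
    refine ⟨_, (h.reflection_mem_signed hv ha).2, _, (h.reflection_mem_signed hv hb).2, ?_⟩
    rw [inner_add_right]
    module

lemma inner_self_cases (h : IsFrame ε c) {v : V} (hv : v ∈ frameRoots ε) :
    ⟪v, v⟫ = 4 * c ∨ ⟪v, v⟫ = 2 * c := by
  rcases h.mem_frameRoots_cases hv with ⟨a, ha, rfl⟩ | ⟨a, ha, b, hb, hab, rfl⟩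
  · refine .inl ?_
    rw [inner_smul_left, inner_smul_right, RCLike.conj_to_real, h.inner_self_of_mem_signed ha]
    ring
  · exact .inr (h.inner_add_self ha hb hab)

/-- For v = tw both 2t and 2/t are integers, so t is ±1/2, ±1 or ±2. The ratio t² of squared lengths
can only be 1/2, 1 or 2, which leaves t = ±1. -/
lemma eq_or_eq_neg_of_smul (h : IsFrame ε c) {v w : V} (hv : v ∈ frameRoots ε)
    (hw : w ∈ frameRoots ε) {t : ℝ} (hvw : v = t • w) : v = w ∨ v = -w := by
  have hc := h.pos
  obtain ⟨z, hz⟩ := h.exists_int_eq hw hv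
  obtain ⟨z', hz'⟩ := h.exists_int_eq hv hw
  have hww : ⟪w, w⟫ ≠ 0 := by simpa using hw.1
  have ht0 : t ≠ 0 := by
    rintro rfl
    exact hv.1 (by simpa using hvw)
  have h1 : ⟪w, v⟫ = t * ⟪w, w⟫ := by rw [hvw, inner_smul_right]
  have h2 : ⟪v, v⟫ = t * t * ⟪w, w⟫ := by
    rw [hvw, inner_smul_right, inner_smul_left, RCLike.conj_to_real, mul_assoc]
  have h3 : ⟪v, w⟫ = t * ⟪w, w⟫ := by rw [real_inner_comm, h1]
  rw [h1] at hz
  rw [h3, h2] at hz'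
  have hz1 : 2 * t = z := by rw [← hz]; field_simp
  have hz2 : 2 = z' * t := by rw [← hz']; field_simp
  have hzz : z * z' = 4 := by
    have : (z : ℝ) * z' = 4 := by rw [← hz1, mul_right_comm, mul_assoc, ← hz2]; norm_num
    exact_mod_cast this
  have hz4 : z ∣ 4 := ⟨z', hzz.symm⟩
  have hzle : z ≤ 4 := Int.le_of_dvd (by norm_num) hz4
  have hzge : -4 ≤ z := by
    have := Int.le_of_dvd (by norm_num) (neg_dvd.2 hz4)
    lia
  rcases h.inner_self_cases hv with h4 | h4 <;> rcases h.inner_self_cases hw with h5 | h5 <;>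
  rw [h2, h5] at h4 <;>
  rw [show t = z / 2 by linarith] at h4 hvw <;>
  interval_cases z <;> push_cast at h4 hvw <;> first
    | exact absurd hz4 (by decide)
    | exact absurd h4 (by intro; linarith)
    | exact .inl (by rw [hvw]; module)
    | exact .inr (by rw [hvw]; module)

lemma linearIndependent (h : IsFrame ε c) : LinearIndependent ℝ ε :=
  linearIndependent_of_ne_zero_of_inner_eq_zero h.ne_zero fun _ _ hij => h.inner_ne hij

lemma finiteDimensional (h : IsFrame ε c) : FiniteDimensional ℝ V :=
  Module.Basis.finiteDimensional_of_finite (Module.Basis.mk h.linearIndependent h.span_eq.ge)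

lemma finrank_eq (h : IsFrame ε c) : Module.finrank ℝ V = n := by
  rw [Module.finrank_eq_card_basis (Module.Basis.mk h.linearIndependent h.span_eq.ge),
    Fintype.card_fin]

end IsFrame

namespace IsFrame

lemma frameSimple_mem (h : IsFrame ε c) (i : Fin n) : frameSimple ε i ∈ frameRoots ε := by
  by_cases hi : i.1 + 1 < n
  · rw [frameSimple_of_lt ε hi]
    exact h.sub_mem_frameRoots (by simp [Fin.ext_iff])
  · rw [frameSimple_of_not_lt ε hi]
    exact h.add_mem_frameRoots i i

/-- There are n simple roots in dimension n, and they span because each 2ε_i is a sum of them. -/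
lemma linearIndependent_frameSimple (h : IsFrame ε c) :
    LinearIndependent ℝ (frameSimple ε) := by
  have := h.finiteDimensional
  refine linearIndependent_of_top_le_span_of_card_eq_finrank ?_ (by simp [h.finrank_eq])
  rw [← h.span_eq, Submodule.span_le]
  rintro _ ⟨i, rfl⟩
  have h1 : ε i + ε i ∈ Submodule.span ℝ (Set.range (frameSimple ε)) :=
    Submodule.closure_subset_span (R := ℝ) (add_self_mem_closure_frameSimple i)
  have h2 := Submodule.smul_mem _ (1 / 2 : ℝ) h1
  rwa [smul_add, ← add_smul, add_halves, one_smul] at h2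

lemma span_frameRoots (h : IsFrame ε c) : Submodule.span ℝ (frameRoots ε) = ⊤ := by
  rw [eq_top_iff, ← h.span_eq, Submodule.span_le]
  rintro _ ⟨i, rfl⟩
  have h2 := Submodule.smul_mem _ (1 / 2 : ℝ)
    (Submodule.subset_span (R := ℝ) (h.add_mem_frameRoots i i))
  rwa [smul_add, ← add_smul, add_halves, one_smul] at h2

lemma frameSimple_pairing (h : IsFrame ε c) (i j : Fin n) :
    2 * ⟪frameSimple ε i, frameSimple ε j⟫ / ⟪frameSimple ε j, frameSimple ε j⟫ =
      CartanMatrix.C n i j := by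
  have hc := h.pos.ne'
  have hi := i.2
  have hj := j.2
  unfold frameSimple CartanMatrix.C
  simp only [Matrix.of_apply]
  by_cases h1 : i.1 + 1 < n <;> by_cases h2 : j.1 + 1 < n <;>
  simp only [h1, h2, dif_pos, dif_neg, not_false_eq_true, inner_add_left, inner_add_right,
    inner_sub_left, inner_sub_right, h.inner_eq, Fin.ext_iff, if_true] <;>
  -- Apart from the special last index, an entry depends only on whether i and j are equal, adjacent
  -- (in either order) or far apart.
  obtain hij | hij | hij | hij | hij : i.1 + 1 < j.1 ∨ i.1 + 1 = j.1 ∨ i.1 = j.1 ∨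
    j.1 + 1 = i.1 ∨ j.1 + 1 < i.1 := by lia
  all_goals first
    | (exfalso; lia)
    | skip
  all_goals
    simp (disch := lia) only [if_pos, if_neg]
    push_cast
    try field_simp
    try ring_nf
    try rw [mul_inv_cancel₀ hc]

end IsFrame
end RootSystem

/-! ### The root pairing and base attached to a frame -/

section RootSystem

variable {V : Type*} [NormedAddCommGroup V] [InnerProductSpace ℝ V] {n : ℕ}
  {ε : Fin n → V} {c : ℝ}

lemma isPerfPair_innerₗ [FiniteDimensional ℝ V] : (innerₗ V).IsPerfPair :=
  .of_injective (fun _ _ hxy => ext_inner_right ℝ fun v => DFunLike.congr_fun hxy v)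
    fun _ _ hxy => ext_inner_left ℝ fun v => DFunLike.congr_fun hxy v

/-- The coroots of a set of nonzero vectors. -/
def frameCoroot (ε : Fin n → V) : frameRoots ε ↪ V where
  toFun v := (2 / ⟪(v : V), (v : V)⟫) • (v : V)
  inj' := by
    intro v w hvw
    have hv : ⟪(v : V), (v : V)⟫ ≠ 0 := by simpa using v.2.1
    have hw : ⟪(w : V), (w : V)⟫ ≠ 0 := by simpa using w.2.1
    have h1 := congrArg (fun x => ⟪x, x⟫) hvw
    simp only [inner_smul_left, inner_smul_right, RCLike.conj_to_real] at h1
    have h2 : ⟪(v : V), (v : V)⟫ = ⟪(w : V), (w : V)⟫ := by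
      field_simp at h1
      linarith
    simp only [h2] at hvw
    exact Subtype.ext (smul_right_injective V (div_ne_zero two_ne_zero hw) hvw)

/-- The root system of a frame. -/
def IsFrame.rootPairing [FiniteDimensional ℝ V] (h : IsFrame ε c) :
    RootPairing (frameRoots ε) ℝ V V :=
  have := isPerfPair_innerₗ (V := V)
  have := finite_frameRoots (ε := ε).to_subtype
  .mk'' (innerₗ V) (Function.Embedding.subtype _) (frameCoroot ε)
    (fun v => by
      have hv : ⟪(v : V), (v : V)⟫ ≠ 0 := by simpa using v.2.1
      change ⟪(v : V), (2 / ⟪(v : V), (v : V)⟫) • (v : V)⟫ = 2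
      rw [inner_smul_right, div_mul_cancel₀ _ hv])
    (by
      rintro v _ ⟨w, rfl⟩
      refine ⟨⟨_, h.reflection_mem_frameRoots v.2 w.2⟩, ?_⟩
      change (w : V) - _ = (w : V) - ⟪(w : V), (2 / ⟪(v : V), (v : V)⟫) • (v : V)⟫ • (v : V)
      rw [inner_smul_right, real_inner_comm (w : V), mul_div_right_comm])
    (by simpa using h.span_frameRoots)

/-- The simple roots of a frame, as roots. -/
def IsFrame.simple (h : IsFrame ε c) (i : Fin n) : frameRoots ε := ⟨_, h.frameSimple_mem i⟩

lemma IsFrame.simple_injective (h : IsFrame ε c) : Function.Injective h.simple := fun _ _ hij =>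
  h.linearIndependent_frameSimple.injective (congrArg Subtype.val hij)

section

variable [FiniteDimensional ℝ V] (h : IsFrame ε c)

lemma IsFrame.rootPairing_root (v : frameRoots ε) : h.rootPairing.root v = v := rfl

lemma IsFrame.rootPairing_pairing (v w : frameRoots ε) :
    h.rootPairing.pairing v w = 2 * ⟪(v : V), (w : V)⟫ / ⟪(w : V), (w : V)⟫ := by
  change ⟪(v : V), (2 / ⟪(w : V), (w : V)⟫) • (w : V)⟫ = _
  rw [inner_smul_right, mul_div_right_comm]

lemma IsFrame.isEuclidean : IsEuclidean h.rootPairing where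
  pairing_eq _ _ := rfl
  coroot_eq _ := rfl

lemma IsFrame.isCrystallographic : h.rootPairing.IsCrystallographic where
  exists_value v w := by
    obtain ⟨z, hz⟩ := h.exists_int_eq w.2 v.2
    exact ⟨z, by rw [h.rootPairing_pairing, real_inner_comm, hz]; rfl⟩

lemma IsFrame.isRootSystem : h.rootPairing.IsRootSystem :=
  have := isPerfPair_innerₗ (V := V)
  have := finite_frameRoots (ε := ε).to_subtype
  RootPairing.isRootSystem_mk'' (hsp := by simpa using h.span_frameRoots) fun v w => by
    obtain ⟨z, hz⟩ := h.exists_int_eq w.2 v.2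
    exact ⟨z, by rw [← hz, real_inner_comm]; exact (h.rootPairing_pairing v w).symm⟩

lemma IsFrame.isReduced : h.rootPairing.IsReduced where
  eq_or_eq_neg v w hvw := by
    have hw : (w : V) ≠ 0 := w.2.1
    rw [LinearIndependent.pair_symm_iff, linearIndependent_fin2] at hvw
    simp only [Matrix.cons_val_one, Matrix.cons_val_zero, not_and, not_forall, not_not] at hvw
    obtain ⟨t, ht⟩ := hvw v.2.1
    rcases h.eq_or_eq_neg_of_smul w.2 v.2 ht.symm with h1 | h1
    · exact .inl h1.symm
    · exact .inr (by rw [h.rootPairing_root, h.rootPairing_root, h1, neg_neg])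

/-- The base of the root system of a frame. -/
def IsFrame.base : h.rootPairing.Base :=
  have := finite_frameRoots (ε := ε).to_subtype
  have := h.isReduced
  have := h.isRootSystem
  have := h.isCrystallographic
  RootPairing.Base.mk' h.rootPairing (Set.range h.simple)
    ((linearIndepOn_range_iff h.simple_injective _).2 h.linearIndependent_frameSimple)
    (fun v => by
      rw [← Set.range_comp]
      exact mem_or_neg_mem_closure_frameSimple v.2)

lemma IsFrame.mem_base_support (v : frameRoots ε) :
    v ∈ h.base.support ↔ v ∈ Set.range h.simple :=
  Set.Finite.mem_toFinset _

end

theorem IsFrame.isRootSystemOfTypeC (h : IsFrame ε c) : IsRootSystemOfTypeC n (frameRoots ε) := by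
  have := h.finiteDimensional
  have := h.isCrystallographic
  refine ⟨finite_frameRoots, h.rootPairing, fun _ => rfl, h.isEuclidean, h.isRootSystem,
    h.isReduced, this, h.base, (Equiv.ofInjective _ h.simple_injective).trans
      (Equiv.subtypeEquivRight fun v => (h.mem_base_support v).symm), fun i j => ?_⟩
  rw [← Int.cast_inj (α := ℝ), ← h.frameSimple_pairing]
  refine (h.base.algebraMap_cartanMatrixIn_apply ℤ _ _).trans ?_
  rw [h.rootPairing_pairing]
  rfl

end RootSystem

/-! ### The frame of a root system of type `C` -/

section ExistsFrame

variable {E : Type*} [NormedAddCommGroup E] [InnerProductSpace ℝ E]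

/-- The Gram matrix of the simple roots determines that of the ε_k, because a_k = ε_k - ε_{k+1} and
a_{l-1} = 2ε_{l-1} can be solved from the end backwards. -/
lemma exists_inner_frame {l : ℕ} (hl : 0 < l) {a : ℕ → E} {c : ℝ}
    (hlast : ⟪a (l - 1), a (l - 1)⟫ = 4 * c)
    (hself : ∀ k, k + 1 < l → ⟪a k, a k⟫ = 2 * c)
    (hnext : ∀ k, k + 2 < l → ⟪a k, a (k + 1)⟫ = -c)
    (hnext' : ∀ k, k + 2 = l → ⟪a k, a (k + 1)⟫ = -(2 * c))
    (hfar : ∀ k m, k + 1 < m → m < l → ⟪a k, a m⟫ = 0) :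
    ∃ ε : ℕ → E, (∀ i < l, ∀ j < l, ⟪ε i, ε j⟫ = if i = j then c else 0) ∧
      (∀ k, k + 1 < l → a k = ε k - ε (k + 1)) ∧ a (l - 1) = ε (l - 1) + ε (l - 1) := by
  -- The solution of the telescoping relations: the sum counts the long root a_{l-1} once, whereas
  -- ε_k contains only half of it.
  let ε : ℕ → E := fun k => ∑ m ∈ Finset.Ico k l, a m - (1 / 2 : ℝ) • a (l - 1)
  have hε : ∀ k, k + 1 < l → ε k = a k + ε (k + 1) := by
    intro k hk
    simp only [ε]
    rw [Finset.sum_eq_sum_Ico_succ_bot (by lia), add_sub_assoc]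
  have hεl : ε (l - 1) = (1 / 2 : ℝ) • a (l - 1) := by
    have h1 : Finset.Ico (l - 1) l = {l - 1} := by ext; simp; lia
    simp only [ε, h1, Finset.sum_singleton]
    module
  -- Mixed inner products come first, by induction on the distance d of k from the last index; `hN`
  -- then repeats the induction in the second argument.
  have hH : ∀ d k, k + d + 1 = l → ∀ j < l, ⟪ε k, a j⟫ =
      if j + 1 = l then (if k = j then 2 * c else 0)
      else if k = j then c else if k = j + 1 then -c else 0 := by
    intro d
    induction d with
    | zero =>
      intro k hk j hj
      obtain rfl : k = l - 1 := by lia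
      rw [hεl, inner_smul_left, RCLike.conj_to_real]
      rcases lt_trichotomy (j + 2) l with h | h | h
      · rw [real_inner_comm, hfar j _ (by lia) (by lia)]
        simp (disch := lia) only [if_neg]
        ring
      · obtain rfl : l = j + 2 := h.symm
        rw [real_inner_comm, show j + 2 - 1 = j + 1 by lia, hnext' j rfl]
        simp
      · obtain rfl : j = l - 1 := by lia
        rw [hlast]
        simp (disch := lia) only [if_pos]
        ring
    | succ d ih =>
      intro k hk j hj
      rw [hε k (by lia), inner_add_left, ih (k + 1) (by lia) j hj]
      obtain h | h | h | h | h : k + 1 < j ∨ k + 1 = j ∨ k = j ∨ j + 1 = k ∨ j + 1 < k := by lia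
      · rw [hfar k j h hj]
        simp (disch := lia) only [if_neg, ite_self]
        ring
      · subst h
        by_cases hl' : k + 2 = l
        · rw [hnext' k hl']
          simp (disch := lia) only [if_neg, if_pos]
          ring
        · rw [hnext k (by lia)]
          simp (disch := lia) only [if_neg, if_pos]
          ring
      · subst h
        rw [hself k (by lia)]
        simp (disch := lia) only [if_neg, if_pos]
        ring
      · subst h
        rw [real_inner_comm, hnext j (by lia)]
        simp (disch := lia) only [if_neg, if_pos]
        ring
      · rw [real_inner_comm, hfar j k h (by lia)]
        simp (disch := lia) only [if_neg]
        ring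
  have hH' : ∀ k < l, ∀ j < l, ⟪ε k, a j⟫ =
      if j + 1 = l then (if k = j then 2 * c else 0)
      else if k = j then c else if k = j + 1 then -c else 0 :=
    fun k hk => hH (l - 1 - k) k (by lia)
  have hN : ∀ i < l, ∀ d j, j + d + 1 = l → ⟪ε i, ε j⟫ = if i = j then c else 0 := by
    intro i hi d
    induction d with
    | zero =>
      intro j hj
      obtain rfl : j = l - 1 := by lia
      rw [hεl, inner_smul_right, hH' i hi _ (by lia), if_pos (by lia)]
      split_ifs <;> ring
    | succ d ih =>
      intro j hj
      rw [hε j (by lia), inner_add_right, ih (j + 1) (by lia), hH' i hi j (by lia),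
        if_neg (by lia)]
      split_ifs <;> first | lia | ring
  refine ⟨ε, fun i hi j hj => hN i hi (l - 1 - j) j (by lia), fun k hk => ?_, ?_⟩
  · rw [hε k hk, add_sub_cancel_right]
  · rw [hεl, ← add_smul]
    norm_num

variable {ι : Type*} {P : RootPairing ι ℝ E E} [IsEuclidean P]

lemma pairing_eq_inner (i j : ι) :
    P.pairing i j = 2 * ⟪P.root i, P.root j⟫ / ⟪P.root j, P.root j⟫ := by
  change P.toLinearMap (P.root i) (P.coroot j) = _
  rw [IsEuclidean.pairing_eq, IsEuclidean.coroot_eq, inner_smul_right, mul_div_right_comm]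

lemma reflection_eq_inner (i : ι) (x : E) :
    P.reflection i x =
      x - (2 * ⟪P.root i, x⟫ / ⟪P.root i, P.root i⟫) • P.root i := by
  rw [P.reflection_apply]
  change x - P.toLinearMap x (P.coroot i) • P.root i = _
  rw [IsEuclidean.pairing_eq, IsEuclidean.coroot_eq, inner_smul_right, real_inner_comm x,
    mul_div_right_comm]

/-- A root system with a base labelled by type `C` is the root system of a frame. -/
theorem exists_isFrame [P.IsRootSystem] [P.IsCrystallographic] (b : P.Base) {l : ℕ} (hl : 0 < l)
    (e : Fin l ≃ b.support) (he : IsTypeCLabelling b e) :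
    ∃ (ε : Fin l → E) (c : ℝ), IsFrame ε c ∧ ∀ i, P.root (e i) = frameSimple ε i := by
  let a : ℕ → E := fun k => if h : k < l then P.root (e ⟨k, h⟩) else 0
  have ha : ∀ k (hk : k < l), a k = P.root (e ⟨k, hk⟩) := fun k hk => dif_pos hk
  have hne : ∀ k < l, ⟪a k, a k⟫ ≠ 0 := fun k hk => by
    rw [ha k hk]
    simpa using P.ne_zero _
  -- Each Cartan entry is normalized by the second root, so reading a pair in both orders gives the
  -- ratio of the two squared lengths.
  have hC : ∀ i (hi : i < l) j (hj : j < l),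
      2 * ⟪a i, a j⟫ = CartanMatrix.C l ⟨i, hi⟩ ⟨j, hj⟩ * ⟪a j, a j⟫ := by
    intro i hi j hj
    rw [← he, ← div_eq_iff (hne j hj), ha i hi, ha j hj, ← pairing_eq_inner]
    exact (b.algebraMap_cartanMatrixIn_apply ℤ _ _).symm
  have hC1 : ∀ k (hk : k + 1 < l), 2 * ⟪a k, a (k + 1)⟫ = -⟪a (k + 1), a (k + 1)⟫ := by
    intro k hk
    rw [hC k (by lia) (k + 1) hk]
    simp [CartanMatrix.C]
  have hC2 : ∀ k (hk : k + 2 < l), 2 * ⟪a k, a (k + 1)⟫ = -⟪a k, a k⟫ := by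
    intro k hk
    rw [real_inner_comm, hC (k + 1) (by lia) k (by lia)]
    simp [CartanMatrix.C, show k + 1 ≠ l - 1 by lia]
  have hC3 : ∀ k (hk : k + 2 = l), 2 * ⟪a k, a (k + 1)⟫ = -2 * ⟪a k, a k⟫ := by
    intro k hk
    rw [real_inner_comm, hC (k + 1) (by lia) k (by lia)]
    simp only [CartanMatrix.C, Matrix.of_apply, Fin.mk.injEq]
    simp (disch := lia) only [if_pos, if_neg]
    norm_num
  -- The last simple root is to be 2ε_{l-1}, hence has squared length 4c.
  set c := ⟪a (l - 1), a (l - 1)⟫ / 4 with hc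
  have hlast : ⟪a (l - 1), a (l - 1)⟫ = 4 * c := by rw [hc]; ring
  have hself : ∀ d k, k + d + 2 = l → ⟪a k, a k⟫ = 2 * c := by
    intro d
    induction d with
    | zero =>
      intro k hk
      have h1 := hC1 k (by lia)
      have h2 := hC3 k (by lia)
      rw [show k + 1 = l - 1 by lia, hlast] at h1
      rw [show k + 1 = l - 1 by lia] at h2
      linarith
    | succ d ih =>
      intro k hk
      have h1 := hC1 k (by lia)
      have h2 := hC2 k (by lia)
      rw [ih (k + 1) (by lia)] at h1
      linarith
  have hself' : ∀ k, k + 1 < l → ⟪a k, a k⟫ = 2 * c := fun k hk => hself (l - 2 - k) k (by lia)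
  obtain ⟨ε, hε, h1, h2⟩ := exists_inner_frame hl hlast hself'
    (fun k hk => by linarith [hC2 k hk, hself' k (by lia)])
    (fun k hk => by linarith [hC3 k hk, hself' k (by lia)])
    (fun k m hkm hm => by
      have := hC k (by lia) m hm
      simp only [CartanMatrix.C, Matrix.of_apply, Fin.mk.injEq] at this
      simp (disch := lia) only [if_neg] at this
      simpa using this)
  have hsimple : ∀ i, P.root (e i) = frameSimple (fun i : Fin l => ε i) i := by
    intro i
    have hi := i.2
    rw [← ha i i.2]
    by_cases hil : i.1 + 1 < l
    · rw [frameSimple_of_lt _ hil, h1 i hil]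
    · rw [frameSimple_of_not_lt _ hil]
      simpa only [show l - 1 = i.1 by lia] using h2
  refine ⟨fun i => ε i, c, ⟨?_, fun i j => ?_, ?_⟩, hsimple⟩
  · have := hne (l - 1) (by lia)
    have h0 : 0 ≤ ⟪a (l - 1), a (l - 1)⟫ := real_inner_self_nonneg
    rw [hlast] at this h0
    have : c ≠ 0 := by rintro h; simp [h] at this
    exact lt_of_le_of_ne (by linarith) this.symm
  · simp only [hε i i.2 j j.2, Fin.ext_iff]
  · rw [eq_top_iff, ← RootPairing.IsRootSystem.span_root_eq_top (P := P), ← RootPairing.rootSpan,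
      ← b.span_root_support,
      Submodule.span_le]
    rintro _ ⟨k, hk, rfl⟩
    obtain ⟨i, hi⟩ := e.surjective ⟨k, hk⟩
    have hki : k = e i := by rw [hi]
    have hmem : ∀ i : Fin l, ε i ∈ Submodule.span ℝ (Set.range fun i : Fin l => ε i) :=
      fun i => Submodule.subset_span ⟨i, rfl⟩
    rw [SetLike.mem_coe, hki, hsimple]
    by_cases hil : i.1 + 1 < l
    · rw [frameSimple_of_lt _ hil]
      exact sub_mem (hmem _) (hmem _)
    · rw [frameSimple_of_not_lt _ hil]
      exact add_mem (hmem _) (hmem _)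

end ExistsFrame

/-! ### Word length and longest elements -/

section LongestElement

variable {G R J : Type*} [Group G]

/-- The inversions of `g`. -/
def inversions (φ : G →* Equiv.Perm R) (N : Set R) (g : G) : Set R := {r ∈ N | φ g r ∉ N}

variable {φ : G →* Equiv.Perm R} {s : J → G} {a : J → R} {N M : Set R} {neg : R → R}

/-- If r is an inversion of g s_j other than a_j, then s_j r is still in N and is an inversion of g.
-/
lemma image_inversions_subset (hs : ∀ j, s j * s j = 1)
    (hsa : ∀ j, φ (s j) (a j) ∉ N) (hsN : ∀ j, ∀ r ∈ N, r ≠ a j → φ (s j) r ∈ N)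
    (g : G) (j : J) :
    φ (s j) '' (inversions φ N (g * s j) \ {a j}) ⊆ inversions φ N g \ {a j} := by
  rintro _ ⟨r, ⟨⟨hr, hgr⟩, hra⟩, rfl⟩
  refine ⟨⟨hsN j r hr hra, by simpa using hgr⟩, fun h => hsa j ?_⟩
  rw [Set.mem_singleton_iff] at h
  rw [← h, ← Equiv.Perm.mul_apply, ← map_mul, hs, map_one]
  exact hr

variable [Finite R]

lemma ncard_inversions_diff_le (hs : ∀ j, s j * s j = 1)
    (hsa : ∀ j, φ (s j) (a j) ∉ N) (hsN : ∀ j, ∀ r ∈ N, r ≠ a j → φ (s j) r ∈ N)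
    (g : G) (j : J) :
    (inversions φ N (g * s j) \ {a j}).ncard ≤ (inversions φ N g \ {a j}).ncard := by
  rw [← Set.ncard_image_of_injective _ (φ (s j)).injective]
  exact Set.ncard_le_ncard (image_inversions_subset hs hsa hsN g j) (Set.toFinite _)

/-- Appending one letter s_j creates at most one new inversion, namely a_j. This bounds the word
length from below. -/
lemma ncard_inversions_prod_le (hs : ∀ j, s j * s j = 1)
    (hsa : ∀ j, φ (s j) (a j) ∉ N) (hsN : ∀ j, ∀ r ∈ N, r ≠ a j → φ (s j) r ∈ N)
    (l : List G) (hl : ∀ g ∈ l, g ∈ Set.range s) :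
    (inversions φ N l.prod).ncard ≤ l.length := by
  induction l using List.reverseRecOn with
  | nil =>
    have : inversions φ N 1 = ∅ := by
      ext r
      simp [inversions]
    simp [this]
  | append_singleton l g ih =>
    obtain ⟨j, rfl⟩ := hl g (by simp)
    have h1 := ih fun g hg => hl g (by simp [hg])
    have h2 := ncard_inversions_diff_le hs hsa hsN l.prod j
    have h3 : (inversions φ N l.prod \ {a j}).ncard ≤ (inversions φ N l.prod).ncard :=
      Set.ncard_le_ncard Set.sdiff_subset (Set.toFinite _)
    have h4 := Set.ncard_le_ncard_sdiff_add_ncard (inversions φ N (l.prod * s j)) {a j}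
    rw [Set.ncard_singleton] at h4
    rw [List.prod_append, List.prod_singleton, List.length_append, List.length_singleton]
    lia

/-- Conversely, if g sends some a_j out of N, then g s_j has fewer inversions; removing letters in
this way ends at an element preserving positivity of all a_j, which is 1. -/
lemma exists_word (hs : ∀ j, s j * s j = 1) (ha : ∀ j, a j ∈ N)
    (hsa : ∀ j, φ (s j) (a j) ∉ N) (hsN : ∀ j, ∀ r ∈ N, r ≠ a j → φ (s j) r ∈ N)
    (hneg : ∀ g ∈ Subgroup.closure (Set.range s), ∀ j, φ g (a j) ∉ N → φ g (φ (s j) (a j)) ∈ N)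
    (hone : ∀ g ∈ Subgroup.closure (Set.range s), (∀ j, φ g (a j) ∈ N) → g = 1)
    (m : ℕ) (g : G) (hg : g ∈ Subgroup.closure (Set.range s)) (hm : (inversions φ N g).ncard ≤ m) :
    ∃ l : List G, (∀ g ∈ l, g ∈ Set.range s) ∧ l.prod = g ∧
      l.length ≤ (inversions φ N g).ncard := by
  induction m generalizing g with
  | zero =>
    have h0 : inversions φ N g = ∅ := by
      rw [← Set.ncard_eq_zero (Set.toFinite _)]
      lia
    refine ⟨[], by simp, (hone g hg fun j => ?_).symm, by simp⟩
    by_contra h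
    exact (h0 ▸ (⟨ha j, h⟩ : a j ∈ inversions φ N g) : a j ∈ (∅ : Set R))
  | succ m ih =>
    by_cases h : ∀ j, φ g (a j) ∈ N
    · exact ⟨[], by simp, (hone g hg h).symm, by simp⟩
    · push Not at h
      obtain ⟨j, hj⟩ := h
      have h1 := ncard_inversions_diff_le hs hsa hsN g j
      have h2 : a j ∉ inversions φ N (g * s j) := fun h => h.2 (by simpa using hneg g hg j hj)
      have h3 : a j ∈ inversions φ N g := ⟨ha j, hj⟩
      rw [Set.sdiff_singleton_eq_self h2] at h1
      have h4 := Set.ncard_sdiff_singleton_add_one h3 (Set.toFinite _)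
      obtain ⟨l, hl, hlg, hlen⟩ := ih (g * s j)
        (mul_mem hg (Subgroup.subset_closure ⟨j, rfl⟩)) (by lia)
      refine ⟨l ++ [s j], ?_, ?_, ?_⟩
      · simp only [List.mem_append, List.mem_singleton]
        rintro x (hx | rfl)
        · exact hl x hx
        · exact ⟨j, rfl⟩
      · rw [List.prod_append, List.prod_singleton, hlg, mul_assoc, hs, mul_one]
      · rw [List.length_append, List.length_singleton]
        lia

/-- The element of the group generated by the simple reflections `s j` making all positive roots
negative is the longest one. -/
theorem longestElement_eq_of_forall_notMem (hs : ∀ j, s j * s j = 1) (ha : ∀ j, a j ∈ N)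
    (hsa : ∀ j, φ (s j) (a j) = neg (a j))
    (hsN : ∀ j, ∀ r ∈ N, r ≠ a j → φ (s j) r ∈ N)
    (hM : ∀ g ∈ Subgroup.closure (Set.range s), ∀ r ∈ M, φ g r ∈ M) (hNM : N ⊆ M)
    (hnegM : ∀ r ∈ M, neg r ∈ N ↔ r ∉ N) (hneg : ∀ g r, φ g (neg r) = neg (φ g r))
    (hone : ∀ g ∈ Subgroup.closure (Set.range s), (∀ j, φ g (a j) ∈ N) → g = 1)
    {w : G} (hw : w ∈ Subgroup.closure (Set.range s)) (hw2 : w * w = 1) (hwN : ∀ r ∈ N, φ w r ∉ N) :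
    longestElement (Set.range s) = w := by
  have hsa' : ∀ j, φ (s j) (a j) ∉ N := fun j h =>
    (hnegM _ (hNM (ha j))).1 (hsa j ▸ h) (ha j)
  have hneg' : ∀ g ∈ Subgroup.closure (Set.range s), ∀ j, φ g (a j) ∉ N →
      φ g (φ (s j) (a j)) ∈ N := by
    intro g hg j hj
    rw [hsa, hneg]
    exact (hnegM _ (hM g hg _ (hNM (ha j)))).2 hj
  have hlen : ∀ g ∈ Subgroup.closure (Set.range s),
      wordLength (Set.range s) g = (inversions φ N g).ncard := by
    intro g hg
    obtain ⟨l, hl, hlg, hl'⟩ := exists_word hs ha hsa' hsN hneg' hone _ g hg le_rfl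
    have hmem : l.length ∈ {n | ∃ l : List G, (∀ x ∈ l, x ∈ Set.range s) ∧ l.prod = g ∧
        l.length = n} := ⟨l, hl, hlg, rfl⟩
    refine le_antisymm ((Nat.sInf_le hmem).trans hl') (le_csInf ⟨_, hmem⟩ ?_)
    rintro _ ⟨l', hl₁, rfl, rfl⟩
    exact ncard_inversions_prod_le hs hsa' hsN l' hl₁
  have hwI : inversions φ N w = N := by
    ext r
    exact ⟨fun h => h.1, fun h => ⟨h, hwN r h⟩⟩
  have hlong : IsLongest (Set.range s) w := by
    refine ⟨hw, fun v hv => ?_⟩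
    rw [hlen v hv, hlen w hw, hwI]
    exact Set.ncard_le_ncard (fun r hr => hr.1) (Set.toFinite _)
  -- The definition picks some element of maximal length, so uniqueness has to be proved: like w, it
  -- must invert all of N.
  obtain ⟨hg, hmax⟩ : IsLongest (Set.range s) (longestElement (Set.range s)) :=
    Classical.epsilon_spec ⟨w, hlong⟩
  set g := longestElement (Set.range s)
  have hgI : inversions φ N g = N := by
    refine Set.eq_of_subset_of_ncard_le (fun r hr => hr.1) ?_ (Set.toFinite _)
    have := hmax w hw
    rwa [hlen w hw, hlen g hg, hwI] at this
  -- Since both factors invert N, the product keeps every a_j positive.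
  have hgw : g * w = 1 := by
    refine hone _ (mul_mem hg hw) fun j => ?_
    have h1 : neg (φ w (a j)) ∈ N := (hnegM _ (hM w hw _ (hNM (ha j)))).2 (hwN _ (ha j))
    rw [← hgI] at h1
    have h2 := h1.2
    rw [hneg, hnegM, not_not, ← Equiv.Perm.mul_apply, ← map_mul] at h2
    · exact h2
    · exact hM g hg _ (hM w hw _ (hNM (ha j)))
  rw [← mul_one g, ← hw2, ← mul_assoc, hgw, one_mul]

end LongestElement

/-! ### Longest elements of standard parabolic subgroups of a Weyl group -/

section Weyl

variable {ι E : Type*} [NormedAddCommGroup E] [InnerProductSpace ℝ E]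
  {P : RootPairing ι ℝ E E}

/-- The linear functional extending the height. -/
def heightFunctional [P.IsRootSystem] (b : P.Base) : E →ₗ[ℝ] ℝ :=
  b.toWeightBasis.constr ℝ fun _ => (1 : ℝ)

lemma heightFunctional_root [P.IsRootSystem] (b : P.Base) (i : ι) :
    heightFunctional b (P.root i) = b.height i := by
  have h1 : ∀ j ∈ b.support, heightFunctional b (P.root j) = 1 := by
    intro j hj
    have := b.toWeightBasis.constr_basis ℝ (fun _ => (1 : ℝ)) ⟨j, hj⟩
    rwa [b.toWeightBasis_apply] at this
  obtain ⟨f, -, -, hf⟩ := b.exists_root_eq_sum_int i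
  rw [RootPairing.Base.height_eq_sum hf, hf, map_sum, Int.cast_sum]
  refine Finset.sum_congr rfl fun j hj => ?_
  rw [map_zsmul, h1 j hj, zsmul_eq_mul, mul_one]

lemma isPos_iff_heightFunctional [P.IsRootSystem] (b : P.Base) (i : ι) :
    b.IsPos i ↔ 0 < heightFunctional b (P.root i) := by
  rw [heightFunctional_root, RootPairing.Base.isPos_iff, Int.cast_pos]

lemma ofIdx_smul_eq (i : ι) (x : E) :
    RootPairing.weylGroup.ofIdx P i • x = P.reflection i x := rfl

lemma weylGroup_eq_one {g : P.weylGroup} (hg : ∀ x : E, g • x = x) : g = 1 := by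
  refine Subtype.ext (RootPairing.Equiv.weightHom_injective P ?_)
  ext x
  exact hg x

lemma ofIdx_mul_self (i : ι) :
    RootPairing.weylGroup.ofIdx P i * RootPairing.weylGroup.ofIdx P i = 1 :=
  weylGroup_eq_one fun x => by rw [mul_smul, ofIdx_smul_eq, ofIdx_smul_eq, P.reflection_same]

lemma smul_mem_span_of_mem_closure {I : Set ι} {g : P.weylGroup}
    (hg : g ∈ Subgroup.closure (simpleReflections I)) {x : E}
    (hx : x ∈ Submodule.span ℝ (P.root '' I)) : g • x ∈ Submodule.span ℝ (P.root '' I) := by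
  have hs : ∀ i ∈ I, ∀ x ∈ Submodule.span ℝ (P.root '' I),
      RootPairing.weylGroup.ofIdx P i • x ∈ Submodule.span ℝ (P.root '' I) := by
    intro i hi x hx
    rw [ofIdx_smul_eq, P.reflection_apply]
    exact sub_mem hx (Submodule.smul_mem _ _ (Submodule.subset_span ⟨i, hi, rfl⟩))
  -- Carrying g and its inverse together makes the inverse case of the induction immediate.
  have key : ∀ x ∈ Submodule.span ℝ (P.root '' I), g • x ∈ Submodule.span ℝ (P.root '' I) ∧
      g⁻¹ • x ∈ Submodule.span ℝ (P.root '' I) := by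
    induction hg using Subgroup.closure_induction with
    | mem g hg =>
      obtain ⟨i, hi, rfl⟩ := hg
      intro x hx
      refine ⟨hs i hi x hx, ?_⟩
      rw [inv_eq_of_mul_eq_one_left (ofIdx_mul_self i)]
      exact hs i hi x hx
    | one => intro x hx; simpa using hx
    | mul g h _ _ hg hh =>
      intro x hx
      rw [mul_inv_rev, mul_smul, mul_smul]
      exact ⟨(hg _ (hh x hx).1).1, (hh _ (hg x hx).2).2⟩
    | inv g _ hg =>
      intro x hx
      rw [inv_inv]
      exact (hg x hx).symm
  exact (key x hx).1

/-- The inversion criterion is applied to the positive roots in the span of I. An involution sending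
the simple roots in I to negatives of simple roots reverses height on that span, so it inverts them
all. The uniqueness input `hone` is left to be checked on a frame. -/
theorem longestElement_simpleReflections [Finite ι] [P.IsRootSystem] [P.IsReduced]
    [P.IsCrystallographic]
    (b : P.Base) {I : Set ι} (hI : I ⊆ b.support)
    (hone : ∀ g ∈ (Subgroup.closure (simpleReflections I) : Subgroup P.weylGroup),
      (∀ i ∈ I, 0 < heightFunctional b (g • P.root i)) → g = 1)
    {w : P.weylGroup} (hw : w ∈ Subgroup.closure (simpleReflections I)) (hw2 : w * w = 1)
    (hwI : ∀ i ∈ I, ∃ j ∈ b.support, w • P.root i = -P.root j) :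
    longestElement (simpleReflections I : Set P.weylGroup) = w := by
  let U := Submodule.span ℝ (P.root '' I)
  have hrange : (simpleReflections I : Set P.weylGroup) =
      Set.range fun i : I => RootPairing.weylGroup.ofIdx P i := Set.image_eq_range _ _
  have hposroot : ∀ g : P.weylGroup, ∀ i, b.IsPos (P.weylGroupToPerm g i) ↔
      0 < heightFunctional b (g • P.root i) := by
    intro g i
    rw [isPos_iff_heightFunctional, ← P.weylGroup_apply_root]
  have hsupp : ∀ j ∈ b.support, heightFunctional b (P.root j) = 1 := by
    intro j hj
    rw [heightFunctional_root, RootPairing.Base.height_one_of_mem_support hj, Int.cast_one]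
  have hwU : ∀ x ∈ U, heightFunctional b (w • x) = -heightFunctional b x := by
    intro x hx
    induction hx using Submodule.span_induction with
    | mem x hx =>
      obtain ⟨i, hi, rfl⟩ := hx
      obtain ⟨j, hj, hij⟩ := hwI i hi
      rw [hij, map_neg, hsupp j hj, hsupp i (hI hi)]
    | zero => rw [smul_zero, map_zero, neg_zero]
    | add x y _ _ hx hy => rw [smul_add, map_add, map_add, hx, hy, neg_add]
    | smul t x _ hx => rw [smul_comm w t x, LinearMap.map_smul, LinearMap.map_smul, hx, smul_neg]
  let φ := P.weylGroupToPerm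
  let N : Set ι := {i | P.root i ∈ U ∧ b.IsPos i}
  have hφ : ∀ g i, P.root (φ g i) = g • P.root i := fun g i => (P.weylGroup_apply_root g i).symm
  have hM : ∀ g : P.weylGroup, g ∈ Subgroup.closure (simpleReflections I) →
      ∀ r, P.root r ∈ U → P.root (φ g r) ∈ U := by
    intro g hg r hr
    rw [hφ]
    exact smul_mem_span_of_mem_closure hg hr
  have ha : ∀ i : I, (i : ι) ∈ N := fun i => ⟨Submodule.subset_span ⟨i, i.2, rfl⟩,
    RootPairing.Base.isPos_of_mem_support (hI i.2)⟩
  have hsa : ∀ i r, φ (RootPairing.weylGroup.ofIdx P i) r = P.reflectionPerm i r := by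
    intro i r
    apply P.root.injective
    rw [hφ, ofIdx_smul_eq, P.root_reflectionPerm]
  have hsN : ∀ i : I, ∀ r ∈ N, r ≠ i → φ (RootPairing.weylGroup.ofIdx P i) r ∈ N := by
    intro i r hr hri
    refine ⟨hM _ (Subgroup.subset_closure ⟨i, i.2, rfl⟩) r hr.1, ?_⟩
    rw [hsa]
    exact RootPairing.Base.IsPos.reflectionPerm hr.2 (hI i.2) hri
  have hnegM : ∀ r, P.root r ∈ U → (P.reflectionPerm r r ∈ N ↔ r ∉ N) := by
    intro r hr
    have h1 := RootPairing.Base.IsPos.neg_iff_not b r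
    have h2 : P.root (P.reflectionPerm r r) ∈ U := by
      rw [P.root_reflectionPerm, P.reflection_apply_self]
      exact neg_mem hr
    constructor
    · exact fun h h' => h1.1 h.2 h'.2
    · exact fun h => ⟨h2, h1.2 fun h' => h ⟨hr, h'⟩⟩
  have hneg : ∀ g r, φ g (P.reflectionPerm r r) = P.reflectionPerm (φ g r) (φ g r) := by
    intro g r
    apply P.root.injective
    rw [hφ, P.root_reflectionPerm, P.root_reflectionPerm, P.reflection_apply_self,
      P.reflection_apply_self, smul_neg, hφ]
  have hone' : ∀ g : P.weylGroup, g ∈ Subgroup.closure (simpleReflections I) →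
      (∀ i : I, φ g i ∈ N) → g = 1 :=
    fun g hg h => hone g hg fun i hi => (hposroot g i).1 (h ⟨i, hi⟩).2
  have hwN : ∀ r ∈ N, φ w r ∉ N := by
    rintro r ⟨hr, hr'⟩ ⟨-, h⟩
    rw [isPos_iff_heightFunctional] at hr'
    have h' := (hposroot w r).1 h
    rw [hwU _ hr] at h'
    linarith
  rw [hrange] at hM hone' hw ⊢
  exact longestElement_eq_of_forall_notMem (φ := φ) (a := fun i : I => (i : ι))
    (M := {i | P.root i ∈ U}) (neg := fun i => P.reflectionPerm i i)
    (fun i => ofIdx_mul_self _) ha (fun i => hsa _ _) hsN hM (fun i hi => hi.1) hnegM hneg hone'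
    hw hw2 hwN

end Weyl

/-! ### The Weyl group of type `C` and its longest elements -/

section WeylC

variable {ι E : Type*} [NormedAddCommGroup E] [InnerProductSpace ℝ E]
  {P : RootPairing ι ℝ E E} {b : P.Base} {l : ℕ} {e : Fin l ≃ b.support}
  {ε : Fin l → E} {c : ℝ}

lemma IsFrame.smul_eq_of_forall (h : IsFrame ε c) {g g' : P.weylGroup}
    (hg : ∀ i, g • ε i = g' • ε i) (x : E) : g • x = g' • x := by
  have hx : x ∈ Submodule.span ℝ (Set.range ε) := h.span_eq ▸ Submodule.mem_top
  induction hx using Submodule.span_induction with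
  | mem x hx => obtain ⟨i, rfl⟩ := hx; exact hg i
  | zero => simp
  | add x y _ _ hx hy => rw [smul_add, smul_add, hx, hy]
  | smul t x _ hx => rw [smul_comm, smul_comm g', hx]

lemma IsFrame.weylGroup_eq_one (h : IsFrame ε c) {g : P.weylGroup}
    (hg : ∀ i, g • ε i = ε i) : g = 1 :=
  EquivQuasi.weylGroup_eq_one fun x => by
    rw [h.smul_eq_of_forall (g' := 1) (fun i => by rw [hg, one_smul]), one_smul]

lemma mem_simple_iff (hl : 0 < l) (k : ι) :
    k ∈ (b.support : Set ι) \ {(e ⟨l - 1, Nat.sub_lt hl one_pos⟩ : ι)} ↔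
      ∃ i : Fin l, i.1 + 1 < l ∧ k = e i := by
  constructor
  · rintro ⟨hk, hk'⟩
    obtain ⟨i, hi⟩ := e.surjective ⟨k, hk⟩
    refine ⟨i, ?_, by rw [hi]⟩
    by_contra hil
    refine hk' ?_
    rw [Set.mem_singleton_iff, show (⟨l - 1, _⟩ : Fin l) = i from Fin.ext (by simp only; lia), hi]
  · rintro ⟨i, hi, rfl⟩
    refine ⟨(e i).2, fun h => ?_⟩
    have := congrArg Fin.val (e.injective (Subtype.ext (Set.mem_singleton_iff.1 h)))
    simp only at this
    lia

lemma simpleReflections_sdiff_subset (hl : 0 < l) :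
    (Subgroup.closure (simpleReflections ((b.support : Set ι) \
      {(e ⟨l - 1, Nat.sub_lt hl one_pos⟩ : ι)})) : Subgroup P.weylGroup) ≤
      Subgroup.closure (simpleReflections (b.support : Set ι)) :=
  Subgroup.closure_mono (Set.image_mono Set.sdiff_subset)

/-- Since 2ε_{l-1} is simple, ε_{l-1} has height 1/2, and each step towards index 0 adds the height
1 of a simple root. -/
lemma heightFunctional_frame [P.IsRootSystem] (he : ∀ i, P.root (e i) = frameSimple ε i)
    (i : Fin l) :
    heightFunctional b (ε i) = (l : ℝ) - i.1 - 1 / 2 := by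
  have hsimple : ∀ i, heightFunctional b (frameSimple ε i) = 1 := by
    intro i
    rw [← he, heightFunctional_root, RootPairing.Base.height_one_of_mem_support (e i).2,
      Int.cast_one]
  have key : ∀ d, ∀ i : Fin l, i.1 + d + 1 = l → heightFunctional b (ε i) = d + 1 / 2 := by
    intro d
    induction d with
    | zero =>
      intro i hi
      have h1 := hsimple i
      rw [frameSimple_of_not_lt ε (by lia), map_add] at h1
      push_cast
      linarith
    | succ d ih =>
      intro i hi
      have hi' : i.1 + 1 < l := by lia
      have h1 := hsimple i
      rw [frameSimple_of_lt ε hi', map_sub, ih ⟨i.1 + 1, hi'⟩ (by simp only; lia)] at h1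
      push_cast
      linarith
  have h1 := key (l - 1 - i.1) i (by lia)
  have h2 : ((i.1 + (l - 1 - i.1) + 1 : ℕ) : ℝ) = l := by
    congr 1
    lia
  push_cast at h2
  rw [h1]
  linarith

/-- The heights of g ε_i decrease strictly and remain positive. Positivity rules out minus signs, so
g permutes the frame by a strictly increasing map of indices, which is the identity. -/
lemma eq_one_of_height_pos [P.IsRootSystem] (h : IsFrame ε c)
    (he : ∀ i, P.root (e i) = frameSimple ε i) (hl : 0 < l) {g : P.weylGroup}
    (hsig : ∀ i, g • ε i ∈ signed ε)
    (hlt : ∀ i : Fin l, i.1 + 1 < l → 0 < heightFunctional b (g • P.root (e i)))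
    (hlast : 0 < heightFunctional b (g • ε ⟨l - 1, Nat.sub_lt hl one_pos⟩)) : g = 1 := by
  have hstep : ∀ (i : Fin l) (hi : i.1 + 1 < l),
      heightFunctional b (g • ε ⟨i.1 + 1, hi⟩) < heightFunctional b (g • ε i) := by
    intro i hi
    have := hlt i hi
    rw [he, frameSimple_of_lt ε hi, smul_sub, map_sub] at this
    linarith
  have hpos : ∀ d, ∀ i : Fin l, i.1 + d + 1 = l → 0 < heightFunctional b (g • ε i) := by
    intro d
    induction d with
    | zero =>
      intro i hi
      rwa [show i = ⟨l - 1, Nat.sub_lt hl one_pos⟩ from Fin.ext (by simp only; lia)]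
    | succ d ih =>
      intro i hi
      exact (ih ⟨i.1 + 1, by lia⟩ (by simp only; lia)).trans (hstep i (by lia))
  have hk : ∀ i, ∃ k, g • ε i = ε k := by
    intro i
    obtain ⟨k, hk | hk⟩ := hsig i
    · exact ⟨k, hk⟩
    · have h1 := hpos (l - 1 - i.1) i (by lia)
      rw [hk, map_neg, heightFunctional_frame he] at h1
      have h2 : ((k.1 + 1 : ℕ) : ℝ) ≤ l := Nat.cast_le.2 k.2
      push_cast at h2
      linarith
  choose k hk using hk
  have hmono : StrictMono k := by
    obtain ⟨n, rfl⟩ : ∃ n, l = n + 1 := ⟨l - 1, by lia⟩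
    refine Fin.strictMono_iff_lt_succ.2 fun i => ?_
    have h1 := hstep i.castSucc (by simp)
    rw [hk, hk, heightFunctional_frame he, heightFunctional_frame he] at h1
    have h2 : ((k i.castSucc).1 : ℝ) < (k i.succ).1 := by
      have h3 : (⟨i.castSucc.1 + 1, by simp⟩ : Fin (n + 1)) = i.succ := rfl
      rw [h3] at h1
      linarith
    exact_mod_cast h2
  have hid : k = id := le_antisymm hmono.le_id hmono.id_le
  refine h.weylGroup_eq_one fun i => ?_
  rw [hk, hid, id]

section Euclidean

variable [IsEuclidean P] (h : IsFrame ε c) (he : ∀ i, P.root (e i) = frameSimple ε i)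

include h he

lemma ofIdx_smul_frame_of_lt {i : Fin l} (hi : i.1 + 1 < l) (k : Fin l) :
    RootPairing.weylGroup.ofIdx P (e i) • ε k = ε (Equiv.swap i ⟨i.1 + 1, hi⟩ k) := by
  have hc := h.pos.ne'
  have hne : i ≠ ⟨i.1 + 1, hi⟩ := by simp [Fin.ext_iff]
  rw [ofIdx_smul_eq, reflection_eq_inner, he, frameSimple_of_lt _ hi]
  set j : Fin l := ⟨i.1 + 1, hi⟩
  have hn : ⟪ε i - ε j, ε i - ε j⟫ = 2 * c := by
    rw [inner_sub_left, inner_sub_right, inner_sub_right, h.inner_self, h.inner_self,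
      h.inner_ne hne, h.inner_ne hne.symm]
    ring
  rw [hn, inner_sub_left]
  rcases eq_or_ne k i with rfl | hki
  · rw [h.inner_self, h.inner_ne hne.symm, Equiv.swap_apply_left, sub_zero, div_self (by simpa),
      one_smul, sub_sub_cancel]
  · rcases eq_or_ne k j with rfl | hkj
    · rw [h.inner_self, h.inner_ne hne, Equiv.swap_apply_right, zero_sub, mul_neg, neg_div,
        div_self (by simpa), neg_one_smul, sub_neg_eq_add, add_sub_cancel]
    · rw [h.inner_ne hki.symm, h.inner_ne hkj.symm, Equiv.swap_apply_of_ne_of_ne hki hkj]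
      simp

lemma ofIdx_smul_frame_of_not_lt {i : Fin l} (hi : ¬ i.1 + 1 < l) (k : Fin l) :
    RootPairing.weylGroup.ofIdx P (e i) • ε k = if k = i then -ε k else ε k := by
  have hc := h.pos.ne'
  rw [ofIdx_smul_eq, reflection_eq_inner, he, frameSimple_of_not_lt _ hi, inner_add_left,
    inner_add_left, inner_add_right, h.inner_self]
  split_ifs with hk
  · subst hk
    rw [h.inner_self, show 2 * (c + c) / (c + c + (c + c)) = 1 by field_simp; ring]
    module
  · rw [h.inner_ne (Ne.symm hk)]
    simp

/-- The short simple reflections act as adjacent transpositions, which generate the symmetric group.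
-/
lemma exists_smul_eq_perm (hl : 0 < l) (π : Equiv.Perm (Fin l)) :
    ∃ g ∈ (Subgroup.closure (simpleReflections ((b.support : Set ι) \
      {(e ⟨l - 1, Nat.sub_lt hl one_pos⟩ : ι)})) : Subgroup P.weylGroup),
      ∀ i, g • ε i = ε (π i) := by
  obtain ⟨n, rfl⟩ : ∃ n, l = n + 1 := ⟨l - 1, by lia⟩
  have hπ : π ∈ Submonoid.closure
      (Set.range fun i : Fin n => Equiv.swap i.castSucc i.succ) := by
    rw [Equiv.Perm.mclosure_swap_castSucc_succ]
    trivial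
  induction hπ using Submonoid.closure_induction with
  | mem π hπ =>
    obtain ⟨i, rfl⟩ := hπ
    have hi : i.castSucc.1 + 1 < n + 1 := by simp
    refine ⟨_, Subgroup.subset_closure ⟨_, (mem_simple_iff hl _).2 ⟨i.castSucc, hi, rfl⟩, rfl⟩,
      fun k => ?_⟩
    rw [ofIdx_smul_frame_of_lt h he hi]
    rfl
  | one => exact ⟨1, one_mem _, fun i => one_smul _ _⟩
  | mul π σ _ _ hπ hσ =>
    obtain ⟨g, hg, hg'⟩ := hπ
    obtain ⟨g₁, hg₁, hg₁'⟩ := hσ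
    exact ⟨g * g₁, mul_mem hg hg₁, fun i => by rw [mul_smul, hg₁', hg', Equiv.Perm.mul_apply]⟩

lemma exists_perm_of_mem_closure (hl : 0 < l) {g : P.weylGroup}
    (hg : g ∈ Subgroup.closure (simpleReflections ((b.support : Set ι) \
      {(e ⟨l - 1, Nat.sub_lt hl one_pos⟩ : ι)}))) :
    ∃ π : Equiv.Perm (Fin l), ∀ i, g • ε i = ε (π i) := by
  induction hg using Subgroup.closure_induction with
  | mem g hg =>
    obtain ⟨k, hk, rfl⟩ := hg
    obtain ⟨i, hi, rfl⟩ := (mem_simple_iff hl _).1 hk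
    exact ⟨_, ofIdx_smul_frame_of_lt h he hi⟩
  | one => exact ⟨1, fun i => one_smul _ _⟩
  | mul g g₁ _ _ hg hg₁ =>
    obtain ⟨π, hπ⟩ := hg
    obtain ⟨σ, hσ⟩ := hg₁
    exact ⟨π * σ, fun i => by rw [mul_smul, hσ, hπ, Equiv.Perm.mul_apply]⟩
  | inv g _ hg =>
    obtain ⟨π, hπ⟩ := hg
    refine ⟨π⁻¹, fun i => ?_⟩
    rw [inv_smul_eq_iff, hπ, show π (π⁻¹ i) = i from π.apply_symm_apply i]

lemma smul_mem_signed_of_mem_closure {g : P.weylGroup}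
    (hg : g ∈ Subgroup.closure (simpleReflections (b.support : Set ι))) :
    ∀ a ∈ signed ε, g • a ∈ signed ε ∧ g⁻¹ • a ∈ signed ε := by
  have hs : ∀ i ∈ b.support, ∀ a ∈ signed ε, RootPairing.weylGroup.ofIdx P i • a ∈ signed ε := by
    intro i hi a ha
    obtain ⟨k, hk⟩ := e.surjective ⟨i, hi⟩
    have hik : i = e k := by rw [hk]
    rw [ofIdx_smul_eq, reflection_eq_inner]
    refine (h.reflection_mem_signed ?_ ha).2
    rw [hik, he]
    exact h.frameSimple_mem k
  induction hg using Subgroup.closure_induction with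
  | mem g hg =>
    obtain ⟨i, hi, rfl⟩ := hg
    intro a ha
    refine ⟨hs i hi a ha, ?_⟩
    rw [inv_eq_of_mul_eq_one_left (ofIdx_mul_self i)]
    exact hs i hi a ha
  | one => intro a ha; simpa using ha
  | mul g g₁ _ _ hg hg₁ =>
    intro a ha
    rw [mul_inv_rev, mul_smul, mul_smul]
    exact ⟨(hg _ (hg₁ a ha).1).1, (hg₁ _ (hg a ha).2).2⟩
  | inv g _ hg =>
    intro a ha
    rw [inv_inv]
    exact (hg a ha).symm

open Classical in
-- The long simple reflection changes the sign of the last frame vector; conjugating by a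
-- transposition moves this sign change to any index.
lemma exists_smul_eq_flip (hl : 0 < l) (T : Finset (Fin l)) :
    ∃ g ∈ (Subgroup.closure (simpleReflections (b.support : Set ι)) : Subgroup P.weylGroup),
      ∀ i, g • ε i = if i ∈ T then -ε i else ε i := by
  induction T using Finset.induction_on with
  | empty => exact ⟨1, one_mem _, fun i => by simp⟩
  | insert j T hj ih =>
    obtain ⟨g, hg, hg'⟩ := ih
    let last : Fin l := ⟨l - 1, Nat.sub_lt hl one_pos⟩
    obtain ⟨t, ht, ht'⟩ := exists_smul_eq_perm h he hl (Equiv.swap last j)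
    have hlast : ¬ last.1 + 1 < l := by simp only [last]; lia
    have ht₁ := simpleReflections_sdiff_subset hl ht
    refine ⟨t * RootPairing.weylGroup.ofIdx P (e last) * t * g,
      mul_mem (mul_mem (mul_mem ht₁ (Subgroup.subset_closure ⟨_, (e last).2, rfl⟩)) ht₁) hg,
      fun i => ?_⟩
    have key : ∀ i, (t * RootPairing.weylGroup.ofIdx P (e last) * t) • ε i =
        if i = j then -ε i else ε i := by
      intro i
      rw [mul_smul, mul_smul, ht', ofIdx_smul_frame_of_not_lt h he hlast]
      by_cases hi : i = j
      · subst hi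
        rw [Equiv.swap_apply_right, if_pos rfl, if_pos rfl, smul_neg, ht', Equiv.swap_apply_left]
      · rw [if_neg hi, if_neg, ht', Equiv.swap_apply_self]
        intro h'
        exact hi ((Equiv.swap last j).injective (h'.trans (Equiv.swap_apply_right last j).symm))
    rw [mul_smul, hg']
    by_cases hiT : i ∈ T
    · have hij : i ≠ j := by rintro rfl; exact hj hiT
      rw [if_pos hiT, if_pos (Finset.mem_insert_of_mem hiT), smul_neg, key, if_neg hij]
    · rw [if_neg hiT, key]
      simp [hiT]

/-- One inclusion holds since the frame roots contain the simple roots and are stable under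
reflections. For the other, signed permutations carry 2ε_{l-1} and ε_0 - ε_1 to all roots of their
lengths, up to sign. -/
lemma range_root_eq [Finite ι] [P.IsCrystallographic] [P.IsReduced] (hl : 0 < l) :
    Set.range P.root = frameRoots ε := by
  have hsmul : ∀ (g : P.weylGroup) (v : E), v ∈ Set.range P.root → g • v ∈ Set.range P.root := by
    rintro g _ ⟨i, rfl⟩
    exact ⟨_, (P.weylGroup_apply_root g i).symm⟩
  have hneg : ∀ v ∈ Set.range P.root, -v ∈ Set.range P.root := by
    rintro _ ⟨i, rfl⟩
    exact ⟨P.reflectionPerm i i, by rw [P.root_reflectionPerm, P.reflection_apply_self]⟩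
  have hadd : ∀ i, ε i + ε i ∈ Set.range P.root := by
    intro i
    let last : Fin l := ⟨l - 1, Nat.sub_lt hl one_pos⟩
    have hlast : ¬ last.1 + 1 < l := by simp only [last]; lia
    obtain ⟨g, -, hg⟩ := exists_smul_eq_perm h he hl (Equiv.swap last i)
    have := hsmul g _ ⟨_, (he last).trans (frameSimple_of_not_lt ε hlast)⟩
    rwa [smul_add, hg, Equiv.swap_apply_left] at this
  have hsub : ∀ i j, i ≠ j → ε i - ε j ∈ Set.range P.root := by
    intro i j hij
    have hl2 : 1 < l := by
      have := i.2
      have := j.2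
      have : i.1 ≠ j.1 := fun h => hij (Fin.ext h)
      lia
    let k : Fin l := ⟨0, hl⟩
    have hk : k.1 + 1 < l := hl2
    let k' : Fin l := ⟨k.1 + 1, hk⟩
    have hkk : k ≠ k' := by simp [k, k']
    -- The first transposition sends 0 to i; the second moves the image of 1 to j while fixing i.
    let π : Equiv.Perm (Fin l) := Equiv.swap (Equiv.swap k i k') j * Equiv.swap k i
    have hπ : π k = i := by
      simp only [π, Equiv.Perm.mul_apply, Equiv.swap_apply_left]
      refine Equiv.swap_apply_of_ne_of_ne (fun h' => hkk ?_) hij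
      apply (Equiv.swap k i).injective
      rw [← h', Equiv.swap_apply_left]
    have hπ' : π k' = j := by
      simp only [π, Equiv.Perm.mul_apply, Equiv.swap_apply_left]
    obtain ⟨g, -, hg⟩ := exists_smul_eq_perm h he hl π
    have := hsmul g _ ⟨_, (he k).trans (frameSimple_of_lt ε hk)⟩
    rwa [smul_sub, hg, hg, hπ, hπ'] at this
  refine subset_antisymm ?_ ?_
  · rintro _ ⟨i, rfl⟩
    refine RootPairing.Base.induction_reflect (b := b) i (p := fun i => P.root i ∈ frameRoots ε)
      ?_ ?_ ?_
    · intro i hi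
      rw [P.root_reflectionPerm, reflection_eq_inner]
      exact h.reflection_mem_frameRoots hi hi
    · intro i hi
      obtain ⟨k, hk⟩ := e.surjective ⟨i, hi⟩
      have hik : i = e k := by rw [hk]
      rw [hik, he]
      exact h.frameSimple_mem k
    · intro i j hi hj
      obtain ⟨k, hk⟩ := e.surjective ⟨j, hj⟩
      have hik : j = e k := by rw [hk]
      rw [P.root_reflectionPerm, reflection_eq_inner]
      refine h.reflection_mem_frameRoots ?_ hi
      rw [hik, he]
      exact h.frameSimple_mem k
  · have hadd' : ∀ i j, ε i + ε j ∈ Set.range P.root := by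
      intro i j
      rcases eq_or_ne i j with rfl | hij
      · exact hadd i
      · classical
        obtain ⟨g, -, hg⟩ := exists_smul_eq_flip h he hl {j}
        have := hsmul g _ (hsub i j hij)
        rwa [smul_sub, hg, hg, if_neg (by simpa using hij), if_pos (by simp),
          sub_neg_eq_add] at this
    intro v hv
    obtain ⟨i, j, rfl | rfl | ⟨hij, rfl⟩⟩ := eq_of_mem_frameRoots hv
    · exact hadd' i j
    · exact hneg _ (hadd' i j)
    · exact hsub i j hij

section Height

variable [P.IsRootSystem]

variable [Finite ι] [P.IsCrystallographic] [P.IsReduced]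

/-- Changing all signs gives -1 in the Weyl group, and it negates every simple root. -/
lemma longestElement_smul (hl : 0 < l) (i : Fin l) :
    longestElement (simpleReflections (b.support : Set ι) : Set P.weylGroup) • ε i = -ε i := by
  classical
  obtain ⟨w, hw, hw'⟩ := exists_smul_eq_flip h he hl Finset.univ
  simp only [Finset.mem_univ, if_true] at hw'
  rw [longestElement_simpleReflections b subset_rfl ?_ hw ?_ ?_, hw']
  · intro g hg hpos
    refine eq_one_of_height_pos h he hl
      (fun i => (smul_mem_signed_of_mem_closure h he hg _ (mem_signed ε i)).1)
      (fun i _ => hpos _ (e i).2) ?_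
    have h1 := hpos _ (e ⟨l - 1, Nat.sub_lt hl one_pos⟩).2
    rw [he, frameSimple_of_not_lt ε (by simp only; lia), smul_add, map_add] at h1
    linarith
  · exact h.weylGroup_eq_one fun i => by rw [mul_smul, hw', smul_neg, hw', neg_neg]
  · intro k hk
    refine ⟨k, hk, ?_⟩
    obtain ⟨j, hj⟩ := e.surjective ⟨k, hk⟩
    have hjk : k = e j := by rw [hj]
    rw [hjk, he, frameSimple]
    split_ifs
    · rw [smul_sub, hw', hw']; abel
    · rw [smul_add, hw']; abel

/-- The parabolic subgroup acts by permutations of the frame; reversal sends the j-th simple root to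
the negative of the one with index l - 2 - j. The last frame vector always goes to a vector of
positive height, so only the short simple roots need testing for uniqueness. -/
lemma longestElement_sdiff_smul (hl : 0 < l) (i : Fin l) :
    longestElement (simpleReflections ((b.support : Set ι) \
      {(e ⟨l - 1, Nat.sub_lt hl one_pos⟩ : ι)}) : Set P.weylGroup) • ε i = ε i.rev := by
  obtain ⟨w, hw, hw'⟩ := exists_smul_eq_perm h he hl Fin.revPerm
  simp only [Fin.revPerm_apply] at hw'
  rw [longestElement_simpleReflections b Set.sdiff_subset ?_ hw ?_ ?_, hw']
  · intro g hg hpos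
    obtain ⟨π, hπ⟩ := exists_perm_of_mem_closure h he hl hg
    refine eq_one_of_height_pos h he hl (fun i => hπ i ▸ mem_signed ε _)
      (fun i hi => hpos _ ((mem_simple_iff hl _).2 ⟨i, hi, rfl⟩)) ?_
    rw [hπ, heightFunctional_frame he]
    set k := π ⟨l - 1, Nat.sub_lt hl one_pos⟩
    have h2 : ((k.1 + 1 : ℕ) : ℝ) ≤ l := Nat.cast_le.2 k.2
    push_cast at h2
    linarith
  · exact h.weylGroup_eq_one fun i => by rw [mul_smul, hw', hw', Fin.rev_rev]
  · intro k hk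
    obtain ⟨j, hj, rfl⟩ := (mem_simple_iff hl _).1 hk
    have hj' : (Fin.rev ⟨j.1 + 1, hj⟩).1 + 1 < l := by rw [Fin.val_rev]; simp only; lia
    refine ⟨e (Fin.rev ⟨j.1 + 1, hj⟩), (e _).2, ?_⟩
    rw [he, he, frameSimple_of_lt ε hj, frameSimple_of_lt ε hj', smul_sub, hw', hw', neg_sub]
    congr 2
    ext
    simp only [Fin.val_rev]
    lia

lemma omega_smul (hl : 0 < l) (i : Fin l) :
    omega b (e ⟨l - 1, Nat.sub_lt hl one_pos⟩) • ε i = -ε i.rev := by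
  rw [omega, mul_smul, longestElement_smul h he hl, smul_neg, longestElement_sdiff_smul h he hl]

end Height

end Euclidean

end WeylC

/-! ### Tuples symmetric under reversal -/

section Mirror

/-- The avoiding tuples `f` of length `r + r` with `f i + f i.rev = q` for all `i`. -/
def mirrorTuples (q r : ℕ) : Set (Fin (r + r) → ZMod (2 * q)) :=
  {f | f ∈ avoidingTuples q 1 (r + r) ∧ ∀ i, f i + f i.rev = q}

lemma castAdd_ne_rev_castAdd {r : ℕ} (i j : Fin r) :
    Fin.castAdd r i ≠ (Fin.castAdd r j).rev := by
  intro h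
  have := congrArg Fin.val h
  rw [Fin.val_rev, Fin.val_castAdd, Fin.val_castAdd] at this
  lia

lemma exists_eq_castAdd_or_rev {r : ℕ} (k : Fin (r + r)) :
    ∃ i, k = Fin.castAdd r i ∨ k = (Fin.castAdd r i).rev := by
  induction k using Fin.addCases with
  | left i => exact ⟨i, .inl rfl⟩
  | right i =>
    refine ⟨i.rev, .inr (Fin.ext ?_)⟩
    rw [Fin.val_rev, Fin.val_castAdd, Fin.val_rev, Fin.val_natAdd]
    lia

/-- The entries f i and f i.rev have equal parity, so their sum is even and cannot be an odd q. -/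
lemma natCard_mirrorTuples_of_odd {q r : ℕ} (hr : 0 < r) (hq : Odd q) :
    Nat.card (mirrorTuples q r) = 0 := by
  have : IsEmpty (mirrorTuples q r) := by
    refine ⟨fun ⟨f, hf, hf'⟩ => ?_⟩
    let k : Fin (r + r) := ⟨0, by lia⟩
    have h1 := congrArg (parity q) (hf' k)
    rw [map_add, hf.1 k.rev k, CharTwo.add_self_eq_zero, parity_natCast, eq_comm,
      ZMod.natCast_eq_zero_iff_even] at h1
    exact Nat.not_even_iff_odd.2 hq h1
  exact Nat.card_of_isEmpty

/-- A residue killed by 2 is 0 or q. The value q for a sum or difference of entries turns, through f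
j.rev = q - f j, into a forbidden relation with a mirrored entry; this is how dilation by 2 arises.
-/
lemma comp_castAdd_mem_avoidingTuples {q r : ℕ} [NeZero q] {f : Fin (r + r) → ZMod (2 * q)}
    (hf : f ∈ mirrorTuples q r) :
    (fun i => f (Fin.castAdd r i)) ∈ avoidingTuples q 2 r := by
  obtain ⟨⟨hpar, h1, h2⟩, hrev⟩ := hf
  simp only [Nat.cast_one, one_mul] at h1 h2
  have hinj : ∀ {i j : Fin r}, i ≠ j → Fin.castAdd r i ≠ Fin.castAdd r j :=
    fun hij h => hij (Fin.castAdd_injective _ _ h)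
  refine ⟨fun i j => hpar _ _, fun i h => ?_, fun i j hij => ⟨fun h => ?_, fun h => ?_⟩⟩ <;>
    rw [Nat.cast_ofNat, two_mul_eq_zero_iff] at h <;> rcases h with h | h
  · exact h1 _ h
  · refine (h2 _ _ (castAdd_ne_rev_castAdd i i)).2 ?_
    linear_combination h - hrev (Fin.castAdd r i)
  · exact (h2 _ _ (hinj hij)).1 h
  · refine (h2 _ _ (castAdd_ne_rev_castAdd i j)).2 ?_
    linear_combination h - hrev (Fin.castAdd r j)
  · exact (h2 _ _ (hinj hij)).2 h
  · refine (h2 _ _ (castAdd_ne_rev_castAdd i j)).1 ?_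
    linear_combination h + hrev (Fin.castAdd r j) + natCast_add_self (q := q)

/-- Conversely, a forbidden relation between entries of the extended tuple becomes, after doubling,
one for u, except that an entry and its mirror image sum to q ≠ 0. Evenness of q keeps the parity
constant. -/
lemma append_mem_mirrorTuples {q r : ℕ} [NeZero q] (hq : Even q) {u : Fin r → ZMod (2 * q)}
    (hu : u ∈ avoidingTuples q 2 r) :
    Fin.append u (fun i => q - u i.rev) ∈ mirrorTuples q r := by
  set f := Fin.append u (fun i => q - u i.rev) with hf
  have hqq := natCast_add_self (q := q)
  have hq0 := natCast_self_ne_zero (q := q)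
  have hleft : ∀ i, f (Fin.castAdd r i) = u i := fun i => Fin.append_left _ _ _
  have hright : ∀ i, f (Fin.castAdd r i).rev = q - u i := by
    intro i
    have : (Fin.castAdd r i).rev = Fin.natAdd r i.rev := by
      refine Fin.ext ?_
      rw [Fin.val_rev, Fin.val_castAdd, Fin.val_natAdd, Fin.val_rev]
      lia
    rw [this, hf, Fin.append_right, Fin.rev_rev]
  obtain ⟨hpar, h1, h2⟩ := hu
  simp only [Nat.cast_ofNat] at h1 h2
  have hparq : parity q (q : ZMod (2 * q)) = 0 := by
    rw [parity_natCast, ZMod.natCast_eq_zero_iff_even.2 hq]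
  have hpar' : ∀ k i, parity q (f k) = parity q (u i) := by
    intro k i
    obtain ⟨j, rfl | rfl⟩ := exists_eq_castAdd_or_rev k
    · rw [hleft, hpar j i]
    · rw [hright, map_sub, hparq, zero_sub, CharTwo.neg_eq, hpar j i]
  refine ⟨⟨fun k m => ?_, fun k => ?_, fun k m hkm => ?_⟩, fun k => ?_⟩
  · obtain ⟨i, -⟩ := exists_eq_castAdd_or_rev k
    rw [hpar' k i, hpar' m i]
  · rw [Nat.cast_one, one_mul]
    intro h
    obtain ⟨i, rfl | rfl⟩ := exists_eq_castAdd_or_rev k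
    · rw [hleft] at h
      refine h1 i ?_
      linear_combination 2 * h
    · rw [hright] at h
      refine h1 i ?_
      linear_combination -2 * h + 2 * hqq
  · rw [Nat.cast_one, one_mul, one_mul]
    obtain ⟨i, rfl | rfl⟩ := exists_eq_castAdd_or_rev k <;>
      obtain ⟨j, rfl | rfl⟩ := exists_eq_castAdd_or_rev m <;>
      simp only [hleft, hright]
    · have hij : i ≠ j := fun h => hkm (h ▸ rfl)
      exact ⟨fun h => (h2 i j hij).1 (by linear_combination 2 * h),
        fun h => (h2 i j hij).2 (by linear_combination 2 * h)⟩
    · rcases eq_or_ne i j with rfl | hij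
      · exact ⟨fun h => hq0 (by linear_combination h),
          fun h => h1 i (by linear_combination 2 * h + hqq)⟩
      · exact ⟨fun h => (h2 i j hij).2 (by linear_combination 2 * h - hqq),
          fun h => (h2 i j hij).1 (by linear_combination 2 * h + hqq)⟩
    · rcases eq_or_ne i j with rfl | hij
      · exact ⟨fun h => hq0 (by linear_combination h),
          fun h => h1 i (by linear_combination -2 * h + hqq)⟩
      · exact ⟨fun h => (h2 i j hij).2 (by linear_combination -2 * h + hqq),
          fun h => (h2 i j hij).1 (by linear_combination -2 * h + hqq)⟩
    · have hij : i ≠ j := fun h => hkm (h ▸ rfl)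
      exact ⟨fun h => (h2 i j hij).1 (by linear_combination -2 * h + 2 * hqq),
        fun h => (h2 i j hij).2 (by linear_combination -2 * h)⟩
  · obtain ⟨i, rfl | rfl⟩ := exists_eq_castAdd_or_rev k
    · rw [hleft, hright, add_sub_cancel]
    · rw [Fin.rev_rev, hleft, hright, sub_add_cancel]

lemma natCard_mirrorTuples_of_even {q r : ℕ} [NeZero q] (hq : Even q) :
    Nat.card (mirrorTuples q r) = Nat.card (avoidingTuples q 2 r) := by
  refine Nat.card_congr (Equiv.ofBijective
    (fun f => ⟨_, comp_castAdd_mem_avoidingTuples f.2⟩) ⟨?_, ?_⟩)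
  · rintro ⟨f, hf⟩ ⟨g, hg⟩ hfg
    have h1 : ∀ i, f (Fin.castAdd r i) = g (Fin.castAdd r i) :=
      fun i => congrFun (congrArg Subtype.val hfg) i
    refine Subtype.ext (funext fun k => ?_)
    obtain ⟨i, rfl | rfl⟩ := exists_eq_castAdd_or_rev k
    · exact h1 i
    · have h2 := hf.2 (Fin.castAdd r i)
      have h3 := hg.2 (Fin.castAdd r i)
      linear_combination h2 - h3 - h1 i
  · rintro ⟨u, hu⟩
    refine ⟨⟨_, append_mem_mirrorTuples hq hu⟩, Subtype.ext (funext fun i => ?_)⟩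
    exact Fin.append_left u (fun i => (q : ZMod (2 * q)) - u i.rev) i

lemma add_natCast_mem_mirrorTuples {q r : ℕ} {f : Fin (r + r) → ZMod (2 * q)}
    (hf : f ∈ mirrorTuples q r) : (fun i => f i + (q : ZMod (2 * q))) ∈ mirrorTuples q r :=
  ⟨add_natCast_mem_avoidingTuples hf.1, fun i => by
    linear_combination hf.2 i + natCast_add_self (q := q)⟩

end Mirror

/-! ### Membership in the complement read in coordinates -/

section Character

variable {V : Type*} [NormedAddCommGroup V] [InnerProductSpace ℝ V] {n : ℕ}
  {ε : Fin n → V} {c : ℝ}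

lemma IsFrame.mk_mem_modComplement_iff (h : IsFrame ε c) {q : ℕ}
    {x : coweightLattice (frameRoots ε)} {y : Fin n → ℤ} (hx : HasCoords ε x y) :
    (QuotientAddGroup.mk x : ModQ (coweightLattice (frameRoots ε)) q) ∈
      modComplement (frameRoots ε) (coweightLattice (frameRoots ε)) q ↔
      (fun i => (y i : ZMod (2 * q))) ∈ avoidingTuples q 1 n := by
  have h1 := h.modComplement_dilate q 1
  rw [dilate_one] at h1
  rw [h1]
  refine ⟨?_, fun hy => ⟨x, y, hx, rfl, hy⟩⟩
  rintro ⟨x', y', hx', hmk, hy'⟩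
  rcases (h.mk_eq_mk_iff hx' hx).1 hmk with h2 | h2
  · simpa only [h2] using hy'
  · simpa only [h2] using add_natCast_mem_avoidingTuples hy'

end Character

/-! ### Fixed classes of the folding element and the folded root system -/

section Folding

variable {ι E : Type*} [NormedAddCommGroup E] [InnerProductSpace ℝ E]
  {P : RootPairing ι ℝ E E} {c : ℝ}

lemma IsFrame.two_mul_equivChar_one [IsEuclidean P] {n : ℕ} {ε : Fin n → E} (h : IsFrame ε c)
    (hP : Set.range P.root = frameRoots ε) (hn : 0 < n) {q : ℕ} (hq : 0 < q) :
    2 * equivChar P q 1 = Nat.card (avoidingTuples q 1 n) := by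
  rw [← h.two_mul_charQuasi hn hq, dilate_one, equivChar, MulAction.fixedBy_one_eq_univ,
    Nat.card_univ, ← hP, charQuasi]

/-- The number of classes in a set described through coordinates. -/
lemma IsFrame.two_mul_natCard_eq {n : ℕ} {ε : Fin n → E} (h : IsFrame ε c) (hn : 0 < n) {q : ℕ}
    [NeZero q] {Φ : Set E} (hΦ : Φ = frameRoots ε) (S : Set (ModQ (coweightLattice Φ) q))
    {Y : Set (Fin n → ZMod (2 * q))}
    (hY : ∀ f ∈ Y, ∀ i j, parity q (f i) = parity q (f j))
    (hYq : ∀ f ∈ Y, (fun i => f i + q) ∈ Y)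
    (hS : ∀ (x : coweightLattice Φ) (y : Fin n → ℤ), HasCoords ε x y →
      (QuotientAddGroup.mk x ∈ S ↔ (fun i => (y i : ZMod (2 * q))) ∈ Y)) :
    2 * Nat.card S = Nat.card Y := by
  subst hΦ
  rw [← h.two_mul_natCard_classesOf hn hY hYq]
  congr 3
  ext t
  obtain ⟨x, rfl⟩ := QuotientAddGroup.mk_surjective t
  constructor
  · intro ht
    obtain ⟨y, hy, -⟩ := h.exists_hasCoords x.2
    exact ⟨x, y, hy, rfl, (hS x y hy).1 ht⟩
  · rintro ⟨x', y', hx', hmk, hy'⟩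
    rw [← hmk]
    exact (hS x' y' hx').2 hy'

variable {r : ℕ} {ε : Fin (r + r) → E} {ω : P.weylGroup}

section Order

variable (h : IsFrame ε c) (hω : ∀ i, ω • ε i = -ε i.rev)

include hω

lemma IsFrame.mul_self_eq_one (h : IsFrame ε c) : ω * ω = 1 :=
  h.weylGroup_eq_one fun i => by rw [mul_smul, hω, smul_neg, hω, neg_neg, Fin.rev_rev]

lemma IsFrame.orderOf_eq_two (h : IsFrame ε c) (hr : 0 < r) : orderOf ω = 2 := by
  refine orderOf_eq_prime (by rw [pow_two, h.mul_self_eq_one hω]) fun h1 => ?_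
  have h2 := hω ⟨0, by lia⟩
  rw [h1, one_smul, eq_neg_iff_add_eq_zero] at h2
  exact h.add_ne_zero _ _ h2

lemma HasCoords.smul_mirror [IsEuclidean P] {x : E} {y : Fin (r + r) → ℤ}
    (hx : HasCoords ε x y) : HasCoords ε (ω • x) (fun i => -y i.rev) := by
  intro i
  have h1 : ε i = ω • -ε i.rev := by rw [smul_neg, hω, neg_neg, Fin.rev_rev]
  rw [h1, inner_weyl_smul, inner_neg_left, mul_neg, hx]
  push_cast
  rfl

/-- Invariance of the class means y_i + y_{rev i} is constantly 0 or constantly q modulo 2q. As r +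
r is even, i ≠ rev i, and the value 0 lies on a root hyperplane. Keeping Φ and x' free allows Φ to
be replaced by `frameRoots ε`. -/
lemma IsFrame.mk_smul_eq_iff [IsEuclidean P] (h : IsFrame ε c) {q : ℕ}
    {Φ : Set E} (hΦ : Φ = frameRoots ε) {x x' : coweightLattice Φ} {y : Fin (r + r) → ℤ}
    (hx : HasCoords ε x y) (hx' : (x' : E) = ω • (x : E)) :
    ((QuotientAddGroup.mk x : ModQ (coweightLattice Φ) q) ∈
      modComplement Φ (coweightLattice Φ) q ∧
      (QuotientAddGroup.mk x' : ModQ (coweightLattice Φ) q) = QuotientAddGroup.mk x) ↔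
      (fun i => (y i : ZMod (2 * q))) ∈ mirrorTuples q r := by
  subst hΦ
  have hy' : HasCoords ε (x' : E) (fun i => -y i.rev) := by
    rw [hx']
    exact hx.smul_mirror hω
  rw [h.mk_mem_modComplement_iff hx, h.mk_eq_mk_iff hy' hx, mirrorTuples, Set.mem_ofPred_eq]
  refine and_congr_right fun hf => ?_
  have hqq := natCast_add_self (q := q)
  push_cast
  constructor
  · rintro (h1 | h1) i
    · have hne : i ≠ i.rev := by
        intro h2
        have := congrArg Fin.val h2
        rw [Fin.val_rev] at this
        lia
      refine absurd ?_ (hf.2.2 i i.rev hne).1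
      linear_combination h1 i
    · linear_combination h1 i
  · intro h1
    right
    intro i
    linear_combination h1 i

lemma IsFrame.two_mul_equivChar_mirror [IsEuclidean P] (h : IsFrame ε c)
    (hP : Set.range P.root = frameRoots ε) (hr : 0 < r) {q : ℕ} (hq : 0 < q) :
    2 * equivChar P q ω = Nat.card (mirrorTuples q r) := by
  have : NeZero q := ⟨hq.ne'⟩
  rw [equivChar, ← Nat.card_image_of_injective Subtype.val_injective]
  refine h.two_mul_natCard_eq (by lia) hP _ (fun f hf => hf.1.1)
    (fun f hf => add_natCast_mem_mirrorTuples hf) fun x y hx => ?_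
  rw [← h.mk_smul_eq_iff hω hP (x' := weylHom P ω x) hx rfl]
  constructor
  · rintro ⟨t, ht, hxt⟩
    have h1 := congrArg Subtype.val ht
    refine ⟨hxt ▸ t.2, ?_⟩
    rw [← smul_mk, ← hxt]
    exact h1
  · rintro ⟨h1, h2⟩
    exact ⟨⟨_, h1⟩, Subtype.ext h2, rfl⟩

/-- The orthogonal frame of the fixed space obtained by folding. -/
def foldedFrame (ε : Fin (r + r) → E) (hω : ∀ i, ω • ε i = -ε i.rev) (i : Fin r) :
    fixedSpace ω :=
  ⟨(1 / 2 : ℝ) • (ε (Fin.castAdd r i) - ε (Fin.castAdd r i).rev), by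
    change ω • _ = _
    rw [smul_comm, smul_sub, hω, hω, Fin.rev_rev, neg_sub_neg]⟩

lemma IsFrame.average_eq (h : IsFrame ε c) (hr : 0 < r) (x : E) :
    average ω x = (1 / 2 : ℝ) • (x + ω • x) := by
  rw [average, h.orderOf_eq_two hω hr, show Finset.Icc 1 2 = {1, 2} from rfl,
    Finset.sum_pair (by norm_num), pow_one, pow_two, h.mul_self_eq_one hω, one_smul, add_comm]
  norm_num

lemma IsFrame.average_add (h : IsFrame ε c) (hr : 0 < r) (x y : E) :
    average ω (x + y) = average ω x + average ω y := by
  simp only [h.average_eq hω hr, smul_add]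
  abel

lemma IsFrame.average_castAdd (h : IsFrame ε c) (hr : 0 < r) (i : Fin r) :
    average ω (ε (Fin.castAdd r i)) = foldedFrame ε hω i := by
  rw [h.average_eq hω hr, hω, ← sub_eq_add_neg]
  rfl

lemma IsFrame.average_rev (h : IsFrame ε c) (hr : 0 < r) (i : Fin r) :
    average ω (ε (Fin.castAdd r i).rev) = (-foldedFrame ε hω i : fixedSpace ω) := by
  rw [h.average_eq hω hr, hω, Fin.rev_rev, Submodule.coe_neg, foldedFrame]
  module

lemma IsFrame.average_neg (h : IsFrame ε c) (hr : 0 < r) (x : E) :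
    average ω (-x) = -average ω x := by
  rw [h.average_eq hω hr, h.average_eq hω hr, smul_neg, ← neg_add, smul_neg]

lemma IsFrame.average_mem_signed (h : IsFrame ε c) (hr : 0 < r) {a : E} (ha : a ∈ signed ε) :
    ∃ a' ∈ signed (foldedFrame ε hω), average ω a = a' := by
  obtain ⟨k, hk⟩ := ha
  obtain ⟨i, rfl | rfl⟩ := exists_eq_castAdd_or_rev k <;> rcases hk with rfl | rfl
  · exact ⟨_, mem_signed _ i, h.average_castAdd hω hr i⟩
  · exact ⟨_, neg_mem_signed _ i, by rw [h.average_neg hω hr, h.average_castAdd hω hr]; rfl⟩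
  · exact ⟨_, neg_mem_signed _ i, h.average_rev hω hr i⟩
  · exact ⟨_, mem_signed _ i, by
      rw [h.average_neg hω hr, h.average_rev hω hr, Submodule.coe_neg, neg_neg]⟩

lemma IsFrame.exists_average_eq (h : IsFrame ε c) (hr : 0 < r) {a' : fixedSpace ω}
    (ha : a' ∈ signed (foldedFrame ε hω)) : ∃ a ∈ signed ε, average ω a = a' := by
  obtain ⟨i, rfl | rfl⟩ := ha
  · exact ⟨_, mem_signed ε _, h.average_castAdd hω hr i⟩
  · exact ⟨_, mem_signed ε _, h.average_rev hω hr i⟩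

/-- Averaging is additive and maps the signed frame onto the signed folded frame, hence nonzero sums
of two of the former cover those of the latter. -/
lemma IsFrame.foldedRoots_eq (h : IsFrame ε c) (hP : Set.range P.root = frameRoots ε)
    (hr : 0 < r) : foldedRoots P ω = frameRoots (foldedFrame ε hω) := by
  ext v
  refine and_congr_right fun hv => ?_
  constructor
  · rintro ⟨i, hi⟩
    obtain ⟨-, a, ha, b, hb, hab⟩ : P.root i ∈ frameRoots ε := hP ▸ ⟨i, rfl⟩
    obtain ⟨a', ha', haa⟩ := h.average_mem_signed hω hr ha
    obtain ⟨b', hb', hbb⟩ := h.average_mem_signed hω hr hb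
    refine ⟨a', ha', b', hb', Subtype.ext ?_⟩
    rw [← hi, hab, h.average_add hω hr, haa, hbb, Submodule.coe_add]
  · rintro ⟨a', ha', b', hb', rfl⟩
    obtain ⟨a, ha, haa⟩ := h.exists_average_eq hω hr ha'
    obtain ⟨b, hb, hbb⟩ := h.exists_average_eq hω hr hb'
    have hab : average ω (a + b) = (a' + b' : fixedSpace ω) := by
      rw [h.average_add hω hr, haa, hbb, Submodule.coe_add]
    have hmem : a + b ∈ frameRoots ε := by
      refine ⟨fun h0 => hv (Subtype.ext ?_), a, ha, b, hb, rfl⟩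
      rw [← hab, h0, h.average_eq hω hr]
      simp
    rw [← hP] at hmem
    obtain ⟨i, hi⟩ := hmem
    exact ⟨i, by rw [hi, hab]⟩

/-- Half the difference of two orthogonal vectors of squared norm c has squared norm c/2. The folded
vectors span because every fixed vector is its own average. -/
lemma IsFrame.isFrame_foldedFrame (h : IsFrame ε c) (hr : 0 < r) :
    IsFrame (foldedFrame ε hω) (c / 2) where
  pos := half_pos h.pos
  inner_eq i j := by
    have h1 := castAdd_ne_rev_castAdd i j
    have h2 := (castAdd_ne_rev_castAdd j i).symm
    rw [Submodule.coe_inner]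
    simp only [foldedFrame, inner_smul_left, inner_smul_right, inner_sub_left, inner_sub_right,
      h.inner_ne h1, h.inner_ne h2, RCLike.conj_to_real, h.inner_eq, Fin.rev_inj,
      Fin.castAdd_inj]
    split_ifs <;> ring
  span_eq := by
    have key : ∀ z : E, ∃ y ∈ Submodule.span ℝ (Set.range (foldedFrame ε hω)),
        (y : E) = average ω z := by
      intro z
      have hz : z ∈ Submodule.span ℝ (Set.range ε) := h.span_eq ▸ Submodule.mem_top
      induction hz using Submodule.span_induction with
      | mem z hz =>
        obtain ⟨k, rfl⟩ := hz
        obtain ⟨i, rfl | rfl⟩ := exists_eq_castAdd_or_rev k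
        · exact ⟨_, Submodule.subset_span ⟨i, rfl⟩, (h.average_castAdd hω hr i).symm⟩
        · exact ⟨_, neg_mem (Submodule.subset_span ⟨i, rfl⟩), (h.average_rev hω hr i).symm⟩
      | zero => exact ⟨0, zero_mem _, by rw [h.average_eq hω hr]; simp⟩
      | add u v _ _ hu hv =>
        obtain ⟨u', hu', hu⟩ := hu
        obtain ⟨v', hv', hv⟩ := hv
        exact ⟨u' + v', add_mem hu' hv', by
          rw [h.average_add hω hr, Submodule.coe_add, hu, hv]⟩
      | smul a v _ hv =>
        obtain ⟨v', hv', hv⟩ := hv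
        refine ⟨a • v', Submodule.smul_mem _ a hv', ?_⟩
        rw [Submodule.coe_smul, hv, h.average_eq hω hr, h.average_eq hω hr, smul_comm ω a,
          ← smul_add, smul_comm a]
    refine eq_top_iff.2 fun x _ => ?_
    obtain ⟨y, hy, hyx⟩ := key x
    have hx : ω • (x : E) = x := x.2
    have : y = x := by
      refine Subtype.ext ?_
      rw [hyx, h.average_eq hω hr, hx]
      module
    exact this ▸ hy

end Order

end Folding

end EquivQuasi

end

/-! ### The values of the character and the folding formula -/

theorem mainTheorem8 {ι E : Type*} [NormedAddCommGroup E] [InnerProductSpace ℝ E]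
    [FiniteDimensional ℝ E] [Finite ι]
    (P : RootPairing ι ℝ E E) [EquivQuasi.IsEuclidean P] [P.IsRootSystem] [P.IsReduced]
    [P.IsCrystallographic]
    (b : P.Base) (l : ℕ) (hl : Even l) (hl0 : 0 < l)
    (e : Fin l ≃ b.support) (he : EquivQuasi.IsTypeCLabelling b e)
    (ω : P.weylGroup) (hω : ω = EquivQuasi.omega b (e ⟨l - 1, Nat.sub_lt hl0 one_pos⟩)) :
    -- the values at the identity
    (∀ q : ℕ, 0 < q → Odd q →
      (EquivQuasi.equivChar P q 1 : ℤ) = ∏ k ∈ Finset.Icc 1 l, ((q : ℤ) - (2 * (k : ℤ) - 1))) ∧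
    (∀ q : ℕ, 0 < q → Even q →
      (EquivQuasi.equivChar P q 1 : ℤ) =
        (∏ k ∈ Finset.Icc 1 (l - 1), ((q : ℤ) - 2 * (k : ℤ))) * ((q : ℤ) - (l : ℤ))) ∧
    -- the values at `ω_l`
    (∀ q : ℕ, 0 < q → Nat.gcd 4 q = 1 → EquivQuasi.equivChar P q ω = 0) ∧
    (∀ q : ℕ, 0 < q → Nat.gcd 4 q = 2 →
      (EquivQuasi.equivChar P q ω : ℤ) =
        ∏ k ∈ Finset.Icc 1 (l / 2), ((q : ℤ) - (4 * (k : ℤ) - 2))) ∧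
    (∀ q : ℕ, 0 < q → Nat.gcd 4 q = 4 →
      (EquivQuasi.equivChar P q ω : ℤ) =
        (∏ k ∈ Finset.Icc 1 (l / 2 - 1), ((q : ℤ) - 4 * (k : ℤ))) * ((q : ℤ) - (l : ℤ))) ∧
    -- the description by folding to type `C_{l/2}` with dilation `2`
    orderOf ω = 2 ∧
    EquivQuasi.IsRootSystemOfTypeC (l / 2) (EquivQuasi.foldedRoots P ω) ∧
    (∀ q : ℕ, 0 < q →
      EquivQuasi.equivChar P q ω =
        (if orderOf ω ∣ q then Nat.totient (orderOf ω) else 0) *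
          EquivQuasi.charQuasi (EquivQuasi.dilate 2 (EquivQuasi.foldedRoots P ω))
            (EquivQuasi.coweightLattice (EquivQuasi.foldedRoots P ω)) q) := by
  obtain ⟨ε, c, h, hroot⟩ := EquivQuasi.exists_isFrame b hl0 e he
  have hP := EquivQuasi.range_root_eq h hroot hl0
  have hω' : ∀ i, ω • ε i = -ε i.rev := fun i => by
    rw [hω, EquivQuasi.omega_smul h hroot hl0]
  obtain ⟨r, rfl⟩ := hl
  have hr : 0 < r := by lia
  have hrr : (r + r) / 2 = r := by lia
  have hfold := h.foldedRoots_eq hω' hP hr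
  have hframe := h.isFrame_foldedFrame hω' hr
  have hone : ∀ {q : ℕ}, 0 < q → 2 * (EquivQuasi.equivChar P q 1 : ℤ) =
      Nat.card (EquivQuasi.avoidingTuples q 1 (r + r)) := fun hq => by
    exact_mod_cast h.two_mul_equivChar_one hP hl0 hq
  have hmirror := fun {q : ℕ} (hq : 0 < q) => h.two_mul_equivChar_mirror hω' hP hr hq
  have hodd : ∀ {q : ℕ}, Odd q → EquivQuasi.equivChar P q ω = 0 := by
    intro q hq
    have := hmirror hq.pos
    rw [EquivQuasi.natCard_mirrorTuples_of_odd hr hq] at this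
    lia
  have heven : ∀ {q : ℕ}, 0 < q → Even q → 2 * EquivQuasi.equivChar P q ω =
      Nat.card (EquivQuasi.avoidingTuples q 2 r) := by
    intro q hq hq2
    have : NeZero q := ⟨hq.ne'⟩
    rw [hmirror hq, EquivQuasi.natCard_mirrorTuples_of_even hq2]
  have heven' : ∀ {q : ℕ}, 0 < q → Even q → 2 * (EquivQuasi.equivChar P q ω : ℤ) =
      Nat.card (EquivQuasi.avoidingTuples q 2 r) := fun hq hq2 => by
    exact_mod_cast heven hq hq2
  have hgcd : ∀ {q : ℕ}, Even q → ∃ s, q = 2 * s := fun hq => by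
    obtain ⟨s, hs⟩ := hq
    exact ⟨s, by lia⟩
  refine ⟨fun q hq hq2 => ?_, fun q hq hq2 => ?_, fun q hq hq4 => ?_, fun q hq hq4 => ?_,
    fun q hq hq4 => ?_, h.orderOf_eq_two hω' hr, ?_, fun q hq => ?_⟩
  · have h1 := hone hq
    rw [EquivQuasi.natCard_avoidingTuples_one_of_odd hq hq2 hl0] at h1
    exact mul_left_cancel₀ two_ne_zero h1
  · have h1 := hone hq
    rw [EquivQuasi.natCard_avoidingTuples_one_of_even hq hq2 hl0] at h1
    exact mul_left_cancel₀ two_ne_zero h1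
  · refine hodd (Nat.not_even_iff_odd.1 fun hq2 => ?_)
    have := Nat.dvd_gcd (show 2 ∣ 4 by norm_num) hq2.two_dvd
    rw [hq4] at this
    lia
  · have hq2 : Even q := even_iff_two_dvd.2 (hq4 ▸ Nat.gcd_dvd_right 4 q)
    have h1 := heven' hq hq2
    obtain ⟨s, rfl⟩ := hgcd hq2
    -- The gcd with 4 records the parity of s = q/2, which selects the product formula.
    have hs : Odd s := by
      refine Nat.not_even_iff_odd.1 fun hs => ?_
      have := Nat.dvd_gcd (dvd_refl 4) (mul_dvd_mul_left 2 hs.two_dvd)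
      rw [hq4] at this
      lia
    rw [EquivQuasi.natCard_avoidingTuples_two_of_odd hs hr] at h1
    rw [hrr]
    exact mul_left_cancel₀ two_ne_zero h1
  · have h4 : 4 ∣ q := hq4 ▸ Nat.gcd_dvd_right 4 q
    have hq2 : Even q := even_iff_two_dvd.2 (dvd_trans (by norm_num) h4)
    have h1 := heven' hq hq2
    obtain ⟨s, rfl⟩ := hgcd hq2
    have hs : Even s := even_iff_two_dvd.2 (by lia)
    rw [EquivQuasi.natCard_avoidingTuples_two_of_even (by lia) hs hr] at h1
    rw [hrr, ← two_mul]
    exact mul_left_cancel₀ two_ne_zero h1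
  · rw [hrr, hfold]
    exact hframe.isRootSystemOfTypeC
  · rw [h.orderOf_eq_two hω' hr]
    split_ifs with hq2
    · have h1 := heven hq (even_iff_two_dvd.2 hq2)
      have h2 := hframe.two_mul_charQuasi hr hq 2
      rw [Nat.cast_ofNat, ← hfold] at h2
      -- Both sides, when doubled, equal the number of avoiding tuples with d = 2.
      rw [Nat.totient_two, one_mul]
      lia
    · rw [zero_mul]
      exact hodd (Nat.not_even_iff_odd.1 fun h2 => hq2 h2.two_dvd)
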